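/- **Model.** Researchers $0,1,2,\dots$ carry positive integer weights. Researcher $0$ is present at the start, researcher $n\ge1$ arrives at the end of step $n$; $X_i$ is the initial weight of researcher $i$, a positive integer. In step $n\ge 1$ a paper with $\nu_n$ authors is born, $1\le\nu_n\le n$. Let $W(n,i)$ be the weight of researcher $i$ after step $n$, and let $\mathcal F_n$ be the $\sigma$-algebra generated by the first $n$ steps (the initial weights $X_0,\dots,X_n$ and, for each step $m\le n$, the number of authors, the authors and the bonuses). Given $\mathcal F_{n-1}$, $\nu_n=k$ and the bonuses of step $n$, the authors form a group of $k$ of the researchers $0,\dots,n-1$, each group being chosen with probability proportional to the sum of the weights $W(n-1,i)$ of its members. The $\ell$-th author (in the order of the labels) increases his weight by the nonnegative integer bonus $Y_{n,\ell}$, $\ell=1,\dots,\nu_n$. Put $Z_n=Y_{n,1}+\dots+Y_{n,\nu_n}$, and let $\xi_n(j)$ be the number of $i\in\{0,\dots,n\}$ with $W(n,i)=j$. **Assumptions.** (A finite moment generating function means one that is finite in a neighbourhood of $0$.) 1. $X_0,X_1,\dots$ are independent and distributed as $X$; $X_n$ is independent of $(\mathcal F_{n-1},(Y_{n,1},\dots,Y_{n,\nu_n}),\nu_n)$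 for $n\ge1$. 2. $X$ has a finite moment generating function. 3. $(\nu_n,(Y_{n,1},\dots,Y_{n,\nu_n}))$ is independent of $\mathcal F_{n-1}$ for $n\ge1$. 4. $(\nu_n,Y_{n,1},Z_n)\to(\nu,Y,Z)$ in distribution, $\mathbb E\nu_n\to\mathbb E\nu<\infty$ and $\mathbb E\nu_n^2\to\mathbb E\nu^2<\infty$. 5. The conditional distribution of $(Y_{n,1},\dots,Y_{n,\nu_n})$ given $\nu_n=k$ does not depend on $n$ and is exchangeable. 6. $\mathbb E Z_n^2<\infty$ for all $n\ge1$, $\sum_{n}\mathrm{Var}(Z_n)/n^2<\infty$ and $\frac1n\sum_{m=1}^n\mathbb E Z_m\to\mathbb E Z$. 7. $Y$ and $Z$ have finite moment generating functions. 8. $Y$ and all $Y_{n,1}$ are positive with positive probability, and the greatest common divisor of $\{i:\mathbb P(Y=i)>0\}$ is $1$. **Theorem.** There are constants $x_j\ge0$, $j=1,2,\dots$, such that for every $j\ge1$ $$\frac{\xi_n(j)}{n}\to x_j\quad\text{almost surely as } n\to\infty .$$ The constant $x_j$ is positive exactly when the weight $j$ is attainable, that is, when $j=k+i_1+\dots+i_r$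 for some $r\ge0$, some $k$ with $\mathbb P(X=k)>0$ and some $i_1,\dots,i_r$ with $\mathbb P(Y=i_s)>0$ for all $s$. The sequence satisfies, for every $j\ge1$, $$x_j=\frac{\sum_{i=1}^{j-1}x_{j-i}\left[\dfrac{(j-i)\,\mathbb P(Y=i)}{\mathbb EX+\mathbb EZ}+\mathbb E\bigl((\nu-1)\mathbb I(Y=i)\bigr)\right]+\mathbb P(X=j)}{\alpha j+\beta+1},$$ where $\alpha=\dfrac{\mathbb P(Y>0)}{\mathbb EX+\mathbb EZ}$ and $\beta=\mathbb E\bigl((\nu-1)\mathbb I(Y>0)\bigr)$. -/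

import Mathlib

open MeasureTheory ProbabilityTheory Filter Topology

/-- The random data of the publication model with integer weights.
* `X n` : initial weight of researcher `n` (researcher `0` is present at the start, researcher
  `n ≥ 1` arrives in step `n`);
* `ν n` : number of authors of the paper born in step `n`, for `n ≥ 1`;
* `A n` : the set of (labels of) authors of that paper;
* `Y n ℓ` : bonus of its author number `ℓ` (`ℓ = 0, 1, …, ν n - 1`, in the order of the labels).
  So `Y n 0` is the bonus of the first author.
The entries `ν 0`, `A 0`, `Y 0` play no role. -/
structure PublicationProcess (Ω : Type*) [MeasurableSpace Ω] where
  X : ℕ → Ω → ℕ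
  ν : ℕ → Ω → ℕ
  A : ℕ → Ω → Finset ℕ
  Y : ℕ → Ω → ℕ → ℕ
  measurable_X : ∀ n, Measurable (X n)
  measurable_ν : ∀ n, Measurable (ν n)
  measurable_A : ∀ n, Measurable (A n)
  measurable_Y : ∀ n, Measurable (Y n)

namespace PublicationProcess

variable {Ω : Type*} [MeasurableSpace Ω] (M : PublicationProcess Ω)

/-- The bonus of the first author in step `n`. -/
def firstBonus (n : ℕ) (ω : Ω) : ℕ := M.Y n ω 0

/-- The total weight `Z_n = Y_{n,1} + ⋯ + Y_{n,ν_n}` of the paper born in step `n`. -/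
def Z (n : ℕ) (ω : Ω) : ℕ := ∑ ℓ ∈ Finset.range (M.ν n ω), M.Y n ω ℓ

/-- The bonus received by researcher `i` in step `m`: if `i` is an author, it is the bonus whose
index is the number of authors with smaller label; otherwise it is `0`. -/
def bonus (m i : ℕ) (ω : Ω) : ℕ :=
  if i ∈ M.A m ω then M.Y m ω ((M.A m ω).filter (fun a => a < i)).card else 0

/-- The weight `W(n, i)` of researcher `i` after step `n`. -/
def W (n i : ℕ) (ω : Ω) : ℕ := M.X i ω + ∑ m ∈ Finset.Icc 1 n, M.bonus m i ω

/-- The number `ξ_n(j)` of researchers `0, …, n` having weight `j` after step `n`. -/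
def ξ (n j : ℕ) (ω : Ω) : ℕ :=
  ((Finset.range (n + 1)).filter (fun i => M.W n i ω = j)).card

/-- The total weight of the group `s` of researchers after step `n`. -/
def groupWeight (n : ℕ) (s : Finset ℕ) (ω : Ω) : ℝ := ∑ i ∈ s, (M.W n i ω : ℝ)

/-- The σ-algebra generated by the number of authors and their bonuses in step `n`. -/
def stepSigma (n : ℕ) : MeasurableSpace Ω :=
  MeasurableSpace.comap (M.ν n) inferInstance ⊔ MeasurableSpace.comap (M.Y n) inferInstance

/-- The σ-algebra `F_n` generated by the first `n` steps. -/
def history (n : ℕ) : MeasurableSpace Ω :=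
  (⨆ i ∈ Finset.range (n + 1), MeasurableSpace.comap (M.X i) inferInstance) ⊔
    ⨆ m ∈ Finset.Icc 1 n, (M.stepSigma m ⊔ MeasurableSpace.comap (M.A m) inferInstance)

/-- The dynamics of the model. -/
structure IsModel (P : Measure Ω) : Prop where
  /-- Initial weights are positive. -/
  X_pos : ∀ n, ∀ᵐ ω ∂P, 0 < M.X n ω
  /-- `1 ≤ ν_n ≤ n`. -/
  ν_bounds : ∀ n, 1 ≤ n → ∀ᵐ ω ∂P, 1 ≤ M.ν n ω ∧ M.ν n ω ≤ n
  /-- The authors of the `n`th paper form a group of size `ν_n` from researchers `0, …, n-1`. -/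
  authors : ∀ n, 1 ≤ n → ∀ᵐ ω ∂P, M.A n ω ⊆ Finset.range n ∧ (M.A n ω).card = M.ν n ω
  /-- There are only `ν_n` bonuses: the bonus vector is extended by zeros. -/
  Y_zero : ∀ n, 1 ≤ n → ∀ᵐ ω ∂P, ∀ ℓ, M.ν n ω ≤ ℓ → M.Y n ω ℓ = 0
  /-- Given the past and the number of authors and bonuses of step `n + 1`, a group of the
  prescribed size is selected with probability proportional to the sum of its members' weights. -/
  selection : ∀ n, ∀ s ⊆ Finset.range (n + 1),
    P⟦{ω | M.A (n + 1) ω = s} | M.history n ⊔ M.stepSigma (n + 1)⟧ =ᵐ[P] fun ω =>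
      if M.ν (n + 1) ω = s.card then
        M.groupWeight n s ω /
          ∑ t ∈ Finset.powersetCard s.card (Finset.range (n + 1)), M.groupWeight n t ω
      else 0

end PublicationProcess

/-- A nonnegative (integer-valued) random variable has a finite moment generating function (in a
neighbourhood of the origin). -/
def FiniteMGF {Ω : Type*} [MeasurableSpace Ω] (V : Ω → ℕ) (P : Measure Ω) : Prop :=
  ∃ t : ℝ, 0 < t ∧ Integrable (fun ω => Real.exp (t * (V ω : ℝ))) P

/-- The assumptions on the distributions in the publication model. The triple
`(ν, Y, Z)`, living on its own probability space, is the limit in distribution of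
`(ν_n, Y_{n,1}, Z_n)`. -/
structure PublicationProcess.Assumptions {Ω Ω' : Type*} [MeasurableSpace Ω] [MeasurableSpace Ω']
    (M : PublicationProcess Ω) (P : Measure Ω) [IsProbabilityMeasure P]
    (ν Y Z : Ω' → ℕ) (Q : Measure Ω') [IsProbabilityMeasure Q] : Prop where
  /-- The initial weights are independent and identically distributed. -/
  X_indep : iIndepFun M.X P
  X_ident : ∀ n, IdentDistrib (M.X n) (M.X 0) P P
  /-- The initial weight `X_n` is independent of the triplet formed by `F_{n-1}`, the bonuses of
  step `n`, and `ν_n`. -/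
  X_indep_past : ∀ n,
    Indep (MeasurableSpace.comap (M.X (n + 1)) inferInstance)
      (M.history n ⊔ M.stepSigma (n + 1)) P
  X_mgf : FiniteMGF (M.X 0) P
  /-- `ν_n` and the bonuses of step `n` are independent of `F_{n-1}`. -/
  step_indep_past : ∀ n, Indep (M.stepSigma (n + 1)) (M.history n) P
  /-- `(ν_n, Y_{n,1}, Z_n) → (ν, Y, Z)` in distribution. -/
  tendsto_law : TendstoInDistribution
    (fun (n : ℕ) ω => (M.ν n ω, M.firstBonus n ω, M.Z n ω)) atTop
    (fun ω => (ν ω, Y ω, Z ω)) (fun _ => P) Q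
  /-- `E ν_n → E ν < ∞` and `E ν_n² → E ν² < ∞`. -/
  ν_integrable : Integrable (fun ω => (ν ω : ℝ)) Q
  ν_sq_integrable : Integrable (fun ω => (ν ω : ℝ) ^ 2) Q
  tendsto_ν : Tendsto (fun n => ∫ ω, (M.ν n ω : ℝ) ∂P) atTop (𝓝 (∫ ω, (ν ω : ℝ) ∂Q))
  tendsto_ν_sq :
    Tendsto (fun n => ∫ ω, (M.ν n ω : ℝ) ^ 2 ∂P) atTop (𝓝 (∫ ω, (ν ω : ℝ) ^ 2 ∂Q))
  /-- The conditional law of the bonus vector given `ν_n = k` does not depend on `n`. -/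
  Y_cond_law : ∀ m n k, 1 ≤ m → 1 ≤ n →
    P {ω | M.ν m ω = k} ≠ 0 → P {ω | M.ν n ω = k} ≠ 0 →
    (ProbabilityTheory.cond P {ω | M.ν m ω = k}).map (M.Y m) =
      (ProbabilityTheory.cond P {ω | M.ν n ω = k}).map (M.Y n)
  /-- Given `ν_n = k`, the `k` bonuses are interchangeable. -/
  Y_exch : ∀ n k, 1 ≤ n → P {ω | M.ν n ω = k} ≠ 0 →
    ∀ σ : Equiv.Perm ℕ, (∀ ℓ, k ≤ ℓ → σ ℓ = ℓ) →
      (ProbabilityTheory.cond P {ω | M.ν n ω = k}).map (fun ω ℓ => M.Y n ω (σ ℓ)) =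
        (ProbabilityTheory.cond P {ω | M.ν n ω = k}).map (M.Y n)
  /-- `Z_n` has finite second moment, `∑ Var(Z_n) / n² < ∞`, and
  `(E Z_1 + ⋯ + E Z_n) / n → E Z`. -/
  Z_memLp : ∀ n, 1 ≤ n → MemLp (fun ω => (M.Z n ω : ℝ)) 2 P
  Z_var_summable : Summable (fun n : ℕ => variance (fun ω => (M.Z (n + 1) ω : ℝ)) P
    / ((n : ℝ) + 1) ^ 2)
  tendsto_Z : Tendsto (fun n : ℕ => (∑ m ∈ Finset.Icc 1 n, ∫ ω, (M.Z m ω : ℝ) ∂P) / (n : ℝ)) atTop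
    (𝓝 (∫ ω, (Z ω : ℝ) ∂Q))
  Y_mgf : FiniteMGF Y Q
  Z_mgf : FiniteMGF Z Q
  /-- The bonuses are positive with positive probability. -/
  Yn_pos : ∀ n, 1 ≤ n → 0 < P {ω | 0 < M.firstBonus n ω}
  Y_pos : 0 < Q {ω | 0 < Y ω}
  /-- The greatest common divisor of `{i : P(Y = i) > 0}` is `1`. -/
  Y_gcd : ∀ d : ℕ, (∀ i, 0 < Q {ω | Y ω = i} → d ∣ i) → d = 1

/-- The weight `j` is attainable for the laws of `X` and `Y`: it is the sum of a value that `X`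
takes with positive probability and finitely many (possibly no) values that `Y` takes with positive
probability. -/
def AttainableWeight {Ω Ω' : Type*} [MeasurableSpace Ω] [MeasurableSpace Ω']
    (X : Ω → ℕ) (P : Measure Ω) (Y : Ω' → ℕ) (Q : Measure Ω') (j : ℕ) : Prop :=
  ∃ k, 0 < P {ω | X ω = k} ∧
    ∃ s ∈ AddSubmonoid.closure {i : ℕ | 0 < Q {ω | Y ω = i}}, j = k + s

/-- `E((ν - 1) I(B))`. -/
noncomputable def excessOn {Ω' : Type*} [MeasurableSpace Ω'] (ν : Ω' → ℕ) (Q : Measure Ω')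
    (B : Set Ω') : ℝ :=
  ∫ ω, B.indicator (fun ω => (ν ω : ℝ) - 1) ω ∂Q

/-! Choose k out of n + 1 researchers with probability proportional to the weight of the group, and
let S be the total weight. A researcher of weight w then belongs to the group with probability w/S +
((k - 1)/n)(1 - w/S), as if one place were filled preferentially and the other k - 1 uniformly. By
exchangeability, whatever the rank of this researcher among the authors, the bonus has the law of
the first bonus given that number of authors. This yields the conditional law `condProb_bonus`.
Since S is the sum of all initial weights and all paper weights, laws of large numbers give S/n → m
= EX + EZ almost surely. So n times the conditional probability of a bonus in B, with 0 ∉ B, tends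
to w P(Y ∈ B)/m + E((ν - 1) I(Y ∈ B)).

A weight j is entered from j - l by a bonus l, left by any positive bonus, and also created by
newcomers (`condExp_ξ_increment`). Hence a = ξ(j) satisfies a (n+1) = (1 - u n/(n+1)) a n + v n + d
n. Here u n → αj + β, and v n tends to the numerator of the claimed formula by strong induction on
j. The d n are martingale differences with bounded second moments, because the count moves by at
most ν + 1 in a step. Thus ∑ d n/(n+1) converges almost surely, and the deterministic lemma
`tendsto_div_of_perturbed_recursion` gives a n/n → V/(U + 1). The extra 1 in the denominator is the
cost of dividing by n.

All terms of the limiting recursion are nonnegative, and `attainableWeight_iff` shows that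
attainability obeys the same recursion as positivity of x_j. -/

/-! ### Deterministic recursions with contraction and noise -/

/-- The excess of |z| over a small level η is eventually multiplied by at most exp(-C/(n+1)) per
step. Divergence of the harmonic series drives it to zero. -/
theorem tendsto_zero_of_eventually_contracting {z ε h : ℕ → ℝ} {c : ℝ} (hc : 0 < c)
    (hh : Tendsto h atTop (𝓝 c)) (hε : Tendsto ε atTop (𝓝 0))
    (hz : ∀ᶠ n : ℕ in atTop, z (n + 1) = (1 - h n / (n + 1)) * z n + ε n / (n + 1)) :
    Tendsto z atTop (𝓝 0) := by
  rw [Metric.tendsto_atTop]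
  intro η' hη'
  obtain ⟨η, hη, rfl⟩ : ∃ η > 0, η' = 3 * η := ⟨η' / 3, by positivity, by ring⟩
  -- Half of the limit is an eventual lower bound for h. The upper bound 2C + 1 ≤ n keeps the factor
  -- 1 - h n/(n+1) nonnegative.
  obtain ⟨C, hC, rfl⟩ : ∃ C > 0, c = 2 * C := ⟨c / 2, by positivity, by ring⟩
  have h1 : ∀ᶠ n in atTop, C ≤ h n := hh.eventually (Ici_mem_nhds (by linarith))
  have h2 : ∀ᶠ n : ℕ in atTop, h n ≤ 2 * C + 1 := hh.eventually (Iic_mem_nhds (by linarith))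
  have h3 : ∀ᶠ n : ℕ in atTop, 2 * C + 1 ≤ (n : ℝ) :=
    tendsto_natCast_atTop_atTop.eventually_ge_atTop _
  have h4 : ∀ᶠ n in atTop, |ε n| ≤ η * C := by
    have := hε.abs
    rw [abs_zero] at this
    exact this.eventually (Iic_mem_nhds (by positivity))
  obtain ⟨N, hN⟩ := eventually_atTop.1 (hz.and (h1.and (h2.and (h3.and h4))))
  let w : ℕ → ℝ := fun n => max (|z n| - η) 0
  let H : ℕ → ℝ := fun n => ∑ k ∈ Finset.range n, 1 / ((k : ℝ) + 1)
  have hw0 : ∀ n, 0 ≤ w n := fun n => le_max_right _ _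
  have step : ∀ n ≥ N, w (n + 1) ≤ Real.exp (-(C / (n + 1))) * w n := by
    intro n hn
    obtain ⟨e1, e2, e3, e4, e5⟩ := hN n hn
    have hn0 : (0 : ℝ) < n + 1 := by positivity
    have hq : 0 ≤ 1 - h n / (n + 1) := by
      rw [sub_nonneg, div_le_one hn0]; linarith
    have hexp : 1 - C / (n + 1) ≤ Real.exp (-(C / (n + 1))) := by
      have := Real.add_one_le_exp (-(C / ((n : ℝ) + 1))); linarith
    have hCh : C / (n + 1) ≤ h n / (n + 1) := by gcongr
    have hz1 : |z (n + 1)| ≤ (1 - h n / (n + 1)) * |z n| + η * C / (n + 1) := by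
      rw [e1]
      refine (abs_add_le _ _).trans ?_
      rw [abs_mul, abs_of_nonneg hq, abs_div, abs_of_pos hn0]
      gcongr
    -- The noise is at most ηC/(n+1), exactly what the level η loses under contraction by 1 -
    -- C/(n+1).
    have hz2 : |z (n + 1)| - η ≤ (1 - C / (n + 1)) * (|z n| - η) := by
      have h5 : h n / (n + 1) * |z n| ≥ C / (n + 1) * |z n| := by gcongr
      have h6 : η * C / (n + 1) = C / (n + 1) * η := by ring
      nlinarith
    refine max_le ?_ (mul_nonneg (Real.exp_pos _).le (hw0 n))
    calc |z (n + 1)| - η ≤ (1 - C / (n + 1)) * (|z n| - η) := hz2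
      _ ≤ (1 - C / (n + 1)) * w n := by
          gcongr
          · linarith
          · exact le_max_left _ _
      _ ≤ _ := by gcongr
  have bound : ∀ n ≥ N, w n ≤ w N * Real.exp (-(C * (H n - H N))) := by
    intro n hn
    induction n, hn using Nat.le_induction with
    | base => simp
    | succ n hn ih =>
      calc w (n + 1) ≤ Real.exp (-(C / (n + 1))) * w n := step n hn
        _ ≤ Real.exp (-(C / (n + 1))) * (w N * Real.exp (-(C * (H n - H N)))) := by gcongr
        _ = w N * Real.exp (-(C * (H (n + 1) - H N))) := by
          have : H (n + 1) = H n + 1 / ((n : ℝ) + 1) := Finset.sum_range_succ _ _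
          rw [this, mul_left_comm, ← Real.exp_add]
          congr 2; ring
  have hlim : Tendsto (fun n => w N * Real.exp (-(C * (H n - H N)))) atTop (𝓝 0) := by
    have hH : Tendsto H atTop atTop := Real.tendsto_sum_range_one_div_nat_succ_atTop
    have : Tendsto (fun n => -(C * (H n - H N))) atTop atBot :=
      tendsto_neg_atTop_atBot.comp ((tendsto_atTop_add_const_right _ (-H N) hH).const_mul_atTop hC)
    simpa using (Real.tendsto_exp_atBot.comp this).const_mul (w N)
  obtain ⟨K, hK⟩ := eventually_atTop.1 (hlim.eventually (Iic_mem_nhds hη))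
  refine ⟨max N K, fun n hn => ?_⟩
  have a1 := bound n (le_trans (le_max_left _ _) hn)
  have a2 : _ ≤ η := hK n (le_trans (le_max_right _ _) hn)
  have a3 : |z n| - η ≤ w n := le_max_left _ _
  rw [Real.dist_eq, sub_zero]
  linarith

/-- The noise need not be small term by term: subtracting the tail S n - T of its weighted series
from a n/n cancels it. What remains is a contracting recursion whose error tends to zero. -/
theorem tendsto_div_of_perturbed_recursion {a u v d : ℕ → ℝ} {U V T : ℝ} (hU : 0 < U + 1)
    (hu : Tendsto u atTop (𝓝 U)) (hv : Tendsto v atTop (𝓝 V))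
    (hd : Tendsto (fun n => ∑ k ∈ Finset.range n, d k / ((k : ℝ) + 1)) atTop (𝓝 T))
    (ha : ∀ᶠ n : ℕ in atTop, a (n + 1) = (1 - u n / (n + 1)) * a n + v n + d n) :
    Tendsto (fun n : ℕ => a n / n) atTop (𝓝 (V / (U + 1))) := by
  set S : ℕ → ℝ := fun n => ∑ k ∈ Finset.range n, d k / ((k : ℝ) + 1) with hS
  set c := V / (U + 1) with hc
  have hcV : (U + 1) * c = V := by rw [hc]; field_simp
  have hr : Tendsto (fun n : ℕ => (n : ℝ) / (n + 1)) atTop (𝓝 1) :=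
    tendsto_natCast_div_add_atTop 1
  -- Passing from a n/n to a (n+1)/(n+1) multiplies by (n/(n+1))(1 - u n/(n+1)) = 1 - h n/(n+1).
  let h : ℕ → ℝ := fun n => 1 + u n * (n / (n + 1))
  have hh : Tendsto h atTop (𝓝 (U + 1)) := by
    have := (hu.mul hr).const_add 1
    rwa [mul_one, add_comm 1 U] at this
  have hz : Tendsto (fun n => a n / n - (S n - T) - c) atTop (𝓝 0) := by
    refine tendsto_zero_of_eventually_contracting hU hh
      (ε := fun n => v n - h n * c - h n * (S n - T)) ?_ ?_
    · have := (hv.sub (hh.mul_const c)).sub (hh.mul (hd.sub_const T))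
      simpa [hcV] using this
    · filter_upwards [ha, eventually_gt_atTop 0] with n hn hn0
      have hn1 : (0 : ℝ) < n := by exact_mod_cast hn0
      have hS1 : S (n + 1) = S n + d n / ((n : ℝ) + 1) := Finset.sum_range_succ _ _
      rw [hn, hS1]
      push_cast
      simp only [h]
      field_simp
      ring
  have := (hz.add (hd.sub_const T)).add_const c
  simp only [sub_self, add_zero, zero_add] at this
  exact this.congr fun n => by ring

/-- Kronecker's lemma, as the case of the recursion without drift. -/
theorem tendsto_average_zero_of_tendsto_sum_div {d : ℕ → ℝ} {T : ℝ}
    (hd : Tendsto (fun n => ∑ k ∈ Finset.range n, d k / ((k : ℝ) + 1)) atTop (𝓝 T)) :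
    Tendsto (fun n : ℕ => (∑ k ∈ Finset.range n, d k) / n) atTop (𝓝 0) := by
  have := tendsto_div_of_perturbed_recursion (a := fun n => ∑ k ∈ Finset.range n, d k)
    (u := fun _ => 0) (v := fun _ => 0) (d := d) (U := 0) (V := 0) (by norm_num)
    tendsto_const_nhds tendsto_const_nhds hd
    (Eventually.of_forall fun n => by simp [Finset.sum_range_succ])
  simpa using this

/-! ### Square integrable martingale differences -/

/-- A sum of square integrable martingale differences with summable second moments converges
almost surely. -/
theorem ae_exists_tendsto_sum_of_martingale_difference {Ω : Type*} {m0 : MeasurableSpace Ω}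
    {P : Measure Ω} [IsProbabilityMeasure P] (ℱ : Filtration ℕ m0) {g : ℕ → Ω → ℝ}
    (hg : ∀ n, StronglyMeasurable[ℱ (n + 1)] (g n)) (hL : ∀ n, MemLp (g n) 2 P)
    (hc : ∀ n, P[g n | ℱ n] =ᵐ[P] 0) (hs : Summable fun n => ∫ ω, g n ω ^ 2 ∂P) :
    ∀ᵐ ω ∂P, ∃ T, Tendsto (fun n => ∑ k ∈ Finset.range n, g k ω) atTop (𝓝 T) := by
  let f : ℕ → Ω → ℝ := fun n ω => ∑ k ∈ Finset.range n, g k ω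
  have fsucc : ∀ n, f (n + 1) = f n + g n := fun n => by
    ext ω; exact Finset.sum_range_succ _ _
  have fmeas : ∀ n, StronglyMeasurable[ℱ n] (f n) := fun n => by
    refine Finset.stronglyMeasurable_fun_sum _ fun k hk => ?_
    exact (hg k).mono (ℱ.mono (Finset.mem_range.1 hk))
  have fL : ∀ n, MemLp (f n) 2 P := fun n => memLp_finsetSum _ fun k _ => hL k
  have fM : Martingale f ℱ P := by
    refine martingale_of_condExp_sub_eq_zero_nat fmeas
      (fun n => (fL n).integrable one_le_two) fun n => ?_
    rw [fsucc, add_sub_cancel_left]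
    exact hc n
  -- Increments are orthogonal to the past, so second moments of the partial sums add up.
  have cross : ∀ n, ∫ ω, f n ω * g n ω ∂P = 0 := fun n => by
    have hi : Integrable (f n * g n) P := (fL n).integrable_mul (hL n)
    have h1 := condExp_mul_of_stronglyMeasurable_left (fmeas n) hi ((hL n).integrable one_le_two)
    have h2 : ∫ ω, (f n * g n) ω ∂P = 0 := by
      rw [← integral_condExp (ℱ.le n), integral_congr_ae h1]
      have : f n * P[g n | ℱ n] =ᵐ[P] 0 := by
        filter_upwards [hc n] with ω hω
        simp [hω]
      rw [integral_congr_ae this]; simp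
    exact h2
  have sq : ∀ n, ∫ ω, f n ω ^ 2 ∂P = ∑ k ∈ Finset.range n, ∫ ω, g k ω ^ 2 ∂P := by
    intro n
    induction n with
    | zero => simp [f]
    | succ n ih =>
      rw [Finset.sum_range_succ, ← ih, fsucc]
      have : ∀ ω, (f n + g n) ω ^ 2 = f n ω ^ 2 + 2 * (f n ω * g n ω) + g n ω ^ 2 := fun ω => by
        simp only [Pi.add_apply]; ring
      simp_rw [this]
      have i1 := (fL n).integrable_sq
      have i2 : Integrable (fun ω => 2 * (f n ω * g n ω)) P :=
        ((fL n).integrable_mul (hL n)).const_mul 2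
      have i3 := (hL n).integrable_sq
      have i12 : Integrable (fun ω => f n ω ^ 2 + 2 * (f n ω * g n ω)) P := i1.add i2
      rw [integral_add i12 i3, integral_add i1 i2, integral_const_mul, cross]
      ring
  -- Boundedness in L¹, as martingale convergence requires, follows from |f| ≤ 1 + f².
  have bd : ∀ n, eLpNorm (f n) 1 P ≤ (Real.toNNReal (1 + ∑' n, ∫ ω, g n ω ^ 2 ∂P) : NNReal) := by
    intro n
    rw [eLpNorm_one_eq_lintegral_enorm, ← ofReal_integral_norm_eq_lintegral_enorm
      ((fL n).integrable one_le_two)]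
    refine ENNReal.ofReal_le_ofReal ?_
    calc ∫ ω, ‖f n ω‖ ∂P ≤ ∫ ω, (1 + f n ω ^ 2) ∂P := by
          refine integral_mono ((fL n).integrable one_le_two).norm
            ((integrable_const _).add (fL n).integrable_sq) fun ω => ?_
          simp only [Real.norm_eq_abs]
          rw [← sq_abs]; nlinarith [sq_nonneg (|f n ω| - 1), abs_nonneg (f n ω)]
      _ = 1 + ∑ k ∈ Finset.range n, ∫ ω, g k ω ^ 2 ∂P := by
          rw [integral_add (integrable_const _) (fL n).integrable_sq, sq]; simp
      _ ≤ _ := by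
          gcongr
          exact hs.sum_le_tsum _ fun k _ => integral_nonneg fun ω => sq_nonneg _
  exact fM.submartingale.exists_ae_tendsto_of_bdd bd

/-- The conditional expectation reduces the second moment of a centred variable. -/
theorem integral_sq_sub_condExp_le {Ω : Type*} {m m0 : MeasurableSpace Ω} (hm : m ≤ m0)
    {P : Measure Ω} [IsProbabilityMeasure P] {f : Ω → ℝ} (hf : MemLp f 2 P) :
    ∫ ω, (f ω - P[f | m] ω) ^ 2 ∂P ≤ ∫ ω, f ω ^ 2 ∂P := by
  have h1 : ∫ ω, Var[f; P | m] ω ∂P = ∫ ω, (f ω - P[f | m] ω) ^ 2 ∂P := by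
    rw [ProbabilityTheory.condVar, integral_condExp hm]; rfl
  have h2 : ∫ ω, (f ^ 2) ω ∂P = ∫ ω, P[f ^ 2 | m] ω ∂P := (integral_condExp hm).symm
  rw [← h1]
  refine (integral_mono_ae integrable_condExp integrable_condExp
    (condVar_ae_le_condExp_sq hm hf)).trans ?_
  rw [← h2]; rfl

/-! ### Counting groups chosen in proportion to their weight -/

/-- Double counting: each element lies in C(|R| - 1, k - 1) groups of size k. -/
theorem sum_powersetCard_sum {α : Type*} [DecidableEq α] (R : Finset α) (k : ℕ) (hk : 1 ≤ k)
    (w : α → ℝ) :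
    ∑ t ∈ R.powersetCard k, ∑ l ∈ t, w l = ((R.card - 1).choose (k - 1) : ℝ) * ∑ l ∈ R, w l := by
  have h1 : ∀ t ∈ R.powersetCard k, ∑ l ∈ t, w l = ∑ l ∈ R, if l ∈ t then w l else 0 := by
    intro t ht
    rw [← Finset.sum_filter, Finset.filter_mem_eq_inter,
      Finset.inter_eq_right.2 (Finset.mem_powersetCard.1 ht).1]
  rw [Finset.sum_congr rfl h1, Finset.sum_comm, Finset.mul_sum]
  refine Finset.sum_congr rfl fun l hl => ?_
  rw [← Finset.sum_filter, Finset.sum_const, nsmul_eq_mul]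
  congr 2
  have := Finset.card_filter_powersetCard_subset {l} R k (by simpa using hl) (by simpa using hk)
  simpa using this

theorem choose_sub_two_mul {N k : ℕ} (hN : 2 ≤ N) (hk : 2 ≤ k) :
    ((N - 2).choose (k - 2) : ℝ) * ((N : ℝ) - 1) =
      ((N - 1).choose (k - 1) : ℝ) * ((k : ℝ) - 1) := by
  obtain ⟨N, rfl⟩ := Nat.exists_eq_add_of_le' hN
  obtain ⟨k, rfl⟩ := Nat.exists_eq_add_of_le' hk
  have := Nat.add_one_mul_choose_eq N k
  have h2 : ((N + 1 : ℕ) : ℝ) * (N.choose k : ℝ) = ((N + 1).choose (k + 1) : ℝ) * ((k + 1 : ℕ) : ℝ) := by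
    exact_mod_cast this
  simp only [Nat.add_sub_cancel, show N + 2 - 1 = N + 1 by omega, show k + 2 - 1 = k + 1 by omega]
  push_cast at h2 ⊢
  linarith

/-- The weight of i is counted once per group containing i, that of another l once per group
containing both. `choose_sub_two_mul` turns the ratio of these two counts into (k - 1)/(|R| - 1). -/
theorem sum_powersetCard_sum_of_mem {α : Type*} [DecidableEq α] (R : Finset α) (k : ℕ)
    (hR : 2 ≤ R.card) (hk : 1 ≤ k) (w : α → ℝ) {i : α} (hi : i ∈ R) :
    (∑ t ∈ R.powersetCard k, if i ∈ t then ∑ l ∈ t, w l else 0) =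
      ((R.card - 1).choose (k - 1) : ℝ) *
        (w i + ((k : ℝ) - 1) / ((R.card : ℝ) - 1) * (∑ l ∈ R, w l - w i)) := by
  have h1 : ∀ t ∈ R.powersetCard k, (if i ∈ t then ∑ l ∈ t, w l else 0) =
      ∑ l ∈ R, if i ∈ t ∧ l ∈ t then w l else 0 := by
    intro t ht
    split_ifs with h
    · simp only [h, true_and]
      rw [← Finset.sum_filter, Finset.filter_mem_eq_inter,
        Finset.inter_eq_right.2 (Finset.mem_powersetCard.1 ht).1]
    · simp [h]
  have hR1 : (0 : ℝ) < (R.card : ℝ) - 1 := by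
    have : (2 : ℝ) ≤ R.card := by exact_mod_cast hR
    linarith
  rw [Finset.sum_congr rfl h1, Finset.sum_comm, ← Finset.add_sum_erase R _ hi,
    ← Finset.sum_erase_eq_sub hi, mul_add, Finset.mul_sum, Finset.mul_sum]
  congr 1
  · simp only [and_self]
    rw [← Finset.sum_filter, Finset.sum_const, nsmul_eq_mul]
    congr 2
    have := Finset.card_filter_powersetCard_subset {i} R k (by simpa using hi) (by simpa using hk)
    simpa using this
  · refine Finset.sum_congr rfl fun l hl => ?_
    obtain ⟨hli, hlR⟩ := Finset.mem_erase.1 hl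
    rw [← Finset.sum_filter, Finset.sum_const, nsmul_eq_mul, ← mul_assoc]
    congr 1
    rcases hk.eq_or_lt with rfl | hk2
    · have : ((R.powersetCard 1).filter fun t => i ∈ t ∧ l ∈ t) = ∅ := by
        refine Finset.filter_eq_empty_iff.2 fun t ht h => hli ?_
        exact Finset.card_le_one.1 (Finset.mem_powersetCard.1 ht).2.le _ h.2 _ h.1
      simp [this]
    · have hc : ({i, l} : Finset α).card = 2 := Finset.card_pair hli.symm
      have hs : ({i, l} : Finset α) ⊆ R := by
        intro a ha
        rcases Finset.mem_insert.1 ha with rfl | h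
        · exact hi
        · rwa [Finset.mem_singleton.1 h]
      have h2 := Finset.card_filter_powersetCard_subset {i, l} R k hs (by omega)
      simp only [Finset.insert_subset_iff, Finset.singleton_subset_iff, hc] at h2
      rw [h2, mul_div_assoc', eq_div_iff hR1.ne', choose_sub_two_mul hR hk2]

/-- If groups of size `k` are selected with probability proportional to the sum of the weights of
their members, this is the probability that the selected group contains `i`. -/
theorem sum_powersetCard_ratio_of_mem {α : Type*} [DecidableEq α] (R : Finset α) (k : ℕ)
    (hR : 2 ≤ R.card) (hk : 1 ≤ k) (hkR : k ≤ R.card) (w : α → ℝ) (hw : ∑ l ∈ R, w l ≠ 0)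
    {i : α} (hi : i ∈ R) :
    (∑ s ∈ R.powersetCard k, if i ∈ s then
        (∑ l ∈ s, w l) / ∑ t ∈ R.powersetCard k, ∑ l ∈ t, w l else 0) =
      w i / ∑ l ∈ R, w l + ((k : ℝ) - 1) / ((R.card : ℝ) - 1) * (1 - w i / ∑ l ∈ R, w l) := by
  have hR1 : (0 : ℝ) < (R.card : ℝ) - 1 := by
    have : (2 : ℝ) ≤ R.card := by exact_mod_cast hR
    linarith
  have hch : ((R.card - 1).choose (k - 1) : ℝ) ≠ 0 := by
    exact_mod_cast (Nat.choose_pos (by omega)).ne'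
  have h1 : ∀ s, (if i ∈ s then (∑ l ∈ s, w l) / ∑ t ∈ R.powersetCard k, ∑ l ∈ t, w l else 0) =
      (if i ∈ s then ∑ l ∈ s, w l else 0) / ∑ t ∈ R.powersetCard k, ∑ l ∈ t, w l := by
    intro s; split_ifs <;> simp
  rw [Finset.sum_congr rfl fun s _ => h1 s, ← Finset.sum_div, sum_powersetCard_sum R k hk,
    sum_powersetCard_sum_of_mem R k hR hk w hi, mul_div_mul_left _ _ hch]
  field_simp

/-! ### Expectations under convergence in distribution -/

section Limits

variable {Ω Ω' : Type*} [MeasurableSpace Ω] [MeasurableSpace Ω'] {P : Measure Ω}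
  [IsProbabilityMeasure P] {Q : Measure Ω'} [IsProbabilityMeasure Q]

theorem tendsto_integral_of_tendstoInDistribution {E : Type*} [TopologicalSpace E]
    [DiscreteTopology E] [MeasurableSpace E] [OpensMeasurableSpace E]
    {V : ℕ → Ω → E} {U : Ω' → E}
    (h : TendstoInDistribution V atTop U (fun _ => P) Q) (f : E → ℝ) (C : ℝ)
    (hf : ∀ e, |f e| ≤ C) :
    Tendsto (fun n => ∫ ω, f (V n ω) ∂P) atTop (𝓝 (∫ ω, f (U ω) ∂Q)) := by
  let F : BoundedContinuousFunction E ℝ :=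
    BoundedContinuousFunction.ofNormedAddCommGroup f continuous_of_discreteTopology C hf
  have h1 := (ProbabilityMeasure.tendsto_iff_forall_integral_tendsto.1 h.tendsto) F
  have hF : StronglyMeasurable F :=
    (continuous_of_discreteTopology (f := f)).measurable.stronglyMeasurable
  have e1 : ∀ n, ∫ x, F x ∂(P.map (V n)) = ∫ ω, f (V n ω) ∂P := fun n =>
    integral_map (h.forall_aemeasurable n) hF.aestronglyMeasurable
  have e2 : ∫ x, F x ∂(Q.map U) = ∫ ω, f (U ω) ∂Q :=
    integral_map h.aemeasurable_limit hF.aestronglyMeasurable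
  rw [← e2]
  exact h1.congr e1

/-- The truncation error with a factor b in [0, 1] is dominated by the error without it, hence is
uniform in b. -/
theorem abs_integral_trunc_sub_le {V : Ω → ℕ}
    (hVi : Integrable (fun ω => (V ω : ℝ)) P) {b : Ω → ℝ} (hb : Measurable b)
    (hb0 : ∀ ω, 0 ≤ b ω) (hb1 : ∀ ω, b ω ≤ 1) (K : ℝ) :
    |∫ ω, b ω * V ω ∂P - ∫ ω, b ω * min (V ω : ℝ) K ∂P| ≤
      ∫ ω, (V ω : ℝ) ∂P - ∫ ω, min (V ω : ℝ) K ∂P := by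
  have hmin : Integrable (fun ω => min (V ω : ℝ) K) P := hVi.inf (integrable_const K)
  have hbn : ∀ᵐ ω ∂P, ‖b ω‖ ≤ 1 := Eventually.of_forall fun ω => by
    rw [Real.norm_eq_abs, abs_of_nonneg (hb0 ω)]; exact hb1 ω
  have i1 : Integrable (fun ω => b ω * V ω) P := hVi.bdd_mul hb.aestronglyMeasurable hbn
  have i2 : Integrable (fun ω => b ω * min (V ω : ℝ) K) P :=
    hmin.bdd_mul hb.aestronglyMeasurable hbn
  rw [← integral_sub i1 i2, ← integral_sub hVi hmin]
  refine (abs_integral_le_integral_abs).trans ?_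
  refine integral_mono (i1.sub i2).abs (hVi.sub hmin) fun ω => ?_
  have h0 : 0 ≤ (V ω : ℝ) - min (V ω : ℝ) K := sub_nonneg.2 (min_le_left _ _)
  simp only
  rw [← mul_sub, abs_mul, abs_of_nonneg (hb0 ω), abs_of_nonneg h0]
  exact mul_le_of_le_one_left h0 (hb1 ω)

omit [IsProbabilityMeasure P] in
theorem tendsto_integral_min {V : Ω → ℕ} (hV : Measurable V)
    (hVi : Integrable (fun ω => (V ω : ℝ)) P) :
    Tendsto (fun K : ℕ => ∫ ω, min (V ω : ℝ) K ∂P) atTop (𝓝 (∫ ω, (V ω : ℝ) ∂P)) := by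
  have hVm : Measurable fun ω => (V ω : ℝ) := measurable_from_nat.comp hV
  refine tendsto_integral_of_dominated_convergence (fun ω => (V ω : ℝ))
    (fun K => (hVm.min measurable_const).aestronglyMeasurable) hVi
    (fun K => Eventually.of_forall fun ω => ?_) (Eventually.of_forall fun ω => ?_)
  · rw [Real.norm_eq_abs, abs_of_nonneg (by positivity)]; exact min_le_left _ _
  · refine tendsto_const_nhds.congr' ?_
    filter_upwards [eventually_ge_atTop (V ω)] with K hK
    rw [min_eq_left]; exact_mod_cast hK

/-- Convergence in law handles only bounded functions. Convergence of the means of g supplies the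
missing uniform integrability: at a suitable level K the truncation error is small for the limit,
hence for all large n. -/
theorem tendsto_integral_mul_of_tendstoInDistribution {E : Type*} [TopologicalSpace E]
    [DiscreteTopology E] [MeasurableSpace E] [BorelSpace E]
    {V : ℕ → Ω → E} {U : Ω' → E} (hVm : ∀ n, Measurable (V n)) (hUm : Measurable U)
    (h : TendstoInDistribution V atTop U (fun _ => P) Q) (g : E → ℕ) (b : E → ℝ)
    (hb0 : ∀ e, 0 ≤ b e) (hb1 : ∀ e, b e ≤ 1)
    (hgV : ∀ᶠ n in atTop, Integrable (fun ω => (g (V n ω) : ℝ)) P)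
    (hgU : Integrable (fun ω => (g (U ω) : ℝ)) Q)
    (hg : Tendsto (fun n => ∫ ω, (g (V n ω) : ℝ) ∂P) atTop (𝓝 (∫ ω, (g (U ω) : ℝ) ∂Q))) :
    Tendsto (fun n => ∫ ω, b (V n ω) * g (V n ω) ∂P) atTop
      (𝓝 (∫ ω, b (U ω) * g (U ω) ∂Q)) := by
  have gm : Measurable g := continuous_of_discreteTopology.measurable
  have bm : Measurable b := continuous_of_discreteTopology.measurable
  rw [Metric.tendsto_atTop']
  intro η' hη'
  -- Three errors below η arise: truncation for `V n`, truncation for `U`, and convergence of the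
  -- truncated integrals.
  obtain ⟨η, hη, rfl⟩ : ∃ η > 0, η' = 4 * η := ⟨η' / 4, by positivity, by ring⟩
  have hK := (tendsto_integral_min (gm.comp hUm) hgU).eventually
    (Ioi_mem_nhds (sub_lt_self _ hη))
  obtain ⟨K, hK⟩ := hK.exists
  simp only [Function.comp_apply] at hK
  have hK' : ∫ ω, (g (U ω) : ℝ) ∂Q - η < ∫ ω, min (g (U ω) : ℝ) K ∂Q := hK
  have t1 := tendsto_integral_of_tendstoInDistribution h (fun e => min (g e : ℝ) K) K fun e => by
    rw [abs_of_nonneg (by positivity)]; exact min_le_right _ _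
  have t2 := tendsto_integral_of_tendstoInDistribution h (fun e => b e * min (g e : ℝ) K) K
    fun e => by
      rw [abs_of_nonneg (mul_nonneg (hb0 e) (by positivity))]
      exact (mul_le_of_le_one_left (by positivity) (hb1 e)).trans (min_le_right _ _)
  have t3 := (hg.sub t1).eventually (Iio_mem_nhds (show _ < η by linarith))
  have t4 := t2.eventually (Metric.ball_mem_nhds _ hη)
  obtain ⟨N, hN⟩ := eventually_atTop.1 (hgV.and (t3.and t4))
  refine ⟨N, fun n hn => ?_⟩
  obtain ⟨i, h3, h4⟩ := hN n hn.le
  have a1 := abs_integral_trunc_sub_le i (bm.comp (hVm n)) (fun _ => hb0 _)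
    (fun _ => hb1 _) K
  have a2 := abs_integral_trunc_sub_le hgU (bm.comp hUm) (fun _ => hb0 _)
    (fun _ => hb1 _) K
  simp only [Function.comp_apply, Real.dist_eq] at a1 a2 h3 h4 ⊢
  rw [abs_le] at a1 a2
  rw [abs_lt] at h4 ⊢
  constructor <;> linarith [a1.1, a1.2, a2.1, a2.2, h4.1, h4.2]

end Limits

/-! ### Measurability in the model and bookkeeping of weights -/

instance Finset.measurableSingletonClass_of_countable {α : Type*} [Countable α] :
    MeasurableSingletonClass (Finset α) where
  measurableSet_singleton s := by
    have : ({s} : Set (Finset α)) = ⋂ a, {t | a ∈ t ↔ a ∈ s} := by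
      ext t
      simp [Finset.ext_iff]
    rw [this]
    refine MeasurableSet.iInter fun a => ?_
    by_cases h : a ∈ s
    · simpa [h] using measurable_finset_mem a
    · simpa [h] using (measurable_finset_mem a).not

/-- The position of `a` in a set of labels is a bijection onto an initial segment. -/
theorem Finset.sum_rank (s : Finset ℕ) (f : ℕ → ℕ) :
    ∑ a ∈ s, f (s.filter (fun b => b < a)).card = ∑ l ∈ Finset.range s.card, f l := by
  induction s using Finset.induction_on_max with
  | empty => simp
  | insert a s ha ih =>
    have hn : a ∉ s := fun h => lt_irrefl _ (ha a h)
    rw [Finset.sum_insert hn, Finset.card_insert_of_notMem hn, Finset.sum_range_succ, ← ih,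
      add_comm]
    congr 1
    · refine Finset.sum_congr rfl fun x hx => ?_
      congr 2
      rw [Finset.filter_insert, if_neg (not_lt.2 (ha x hx).le)]
    · congr 2
      rw [Finset.filter_insert, if_neg (lt_irrefl _), Finset.filter_true_of_mem ha]

namespace PublicationProcess

variable {Ω : Type*} [mΩ : MeasurableSpace Ω] (M : PublicationProcess Ω)

theorem stepSigma_le (n : ℕ) : M.stepSigma n ≤ mΩ :=
  sup_le (M.measurable_ν n).comap_le (M.measurable_Y n).comap_le

theorem history_le (n : ℕ) : M.history n ≤ mΩ :=
  sup_le (iSup₂_le fun i _ => (M.measurable_X i).comap_le)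
    (iSup₂_le fun m _ => sup_le (M.stepSigma_le m) (M.measurable_A m).comap_le)

theorem history_mono : Monotone M.history := fun a b hab => by
  refine sup_le_sup ?_ ?_
  · exact biSup_mono fun i hi => by simp only [Finset.mem_range] at *; omega
  · exact biSup_mono fun i hi => by simp only [Finset.mem_Icc] at *; omega

/-- The histories form a filtration. -/
def historyFiltration : Filtration ℕ mΩ := ⟨M.history, M.history_mono, M.history_le⟩

theorem measurable_X_history {n i : ℕ} (h : i ≤ n) : Measurable[M.history n] (M.X i) := by
  refine measurable_iff_comap_le.2 (le_sup_of_le_left ?_)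
  exact le_iSup₂_of_le i (Finset.mem_range.2 (by omega)) le_rfl

theorem step_le_history {n m : ℕ} (h1 : 1 ≤ m) (h : m ≤ n) :
    M.stepSigma m ⊔ MeasurableSpace.comap (M.A m) inferInstance ≤ M.history n :=
  le_sup_of_le_right (le_iSup₂_of_le (f := fun m _ => M.stepSigma m ⊔
    MeasurableSpace.comap (M.A m) inferInstance) m (Finset.mem_Icc.2 ⟨h1, h⟩) le_rfl)

theorem measurable_ν_step (n : ℕ) : Measurable[M.stepSigma n] (M.ν n) :=
  measurable_iff_comap_le.2 le_sup_left

theorem measurable_Y_step (n r : ℕ) : Measurable[M.stepSigma n] (fun ω => M.Y n ω r) :=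
  (measurable_pi_apply r).comp (measurable_iff_comap_le.2 le_sup_right : Measurable[M.stepSigma n] (M.Y n))

theorem measurable_bonus_step (m i : ℕ) :
    Measurable[M.stepSigma m ⊔ MeasurableSpace.comap (M.A m) inferInstance] (M.bonus m i) := by
  have hA : Measurable[M.stepSigma m ⊔ MeasurableSpace.comap (M.A m) inferInstance] (M.A m) :=
    measurable_iff_comap_le.2 le_sup_right
  have hY : Measurable[M.stepSigma m ⊔ MeasurableSpace.comap (M.A m) inferInstance] (M.Y m) :=
    measurable_iff_comap_le.2 (le_sup_of_le_left le_sup_right)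
  have hf : Measurable (fun p : Finset ℕ × (ℕ → ℕ) =>
      if i ∈ p.1 then p.2 ((p.1.filter (fun a => a < i)).card) else 0) := by
    refine measurable_from_prod_countable_right fun s => ?_
    by_cases h : i ∈ s
    · simpa [h] using measurable_pi_apply _
    · simp [h]
  exact hf.comp (hA.prodMk hY)

theorem measurable_bonus_history {n m : ℕ} (h1 : 1 ≤ m) (h : m ≤ n) (i : ℕ) :
    Measurable[M.history n] (M.bonus m i) :=
  (M.measurable_bonus_step m i).mono (M.step_le_history h1 h) le_rfl

theorem measurable_W_history {n i : ℕ} (h : i ≤ n) : Measurable[M.history n] (M.W n i) := by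
  refine Measurable.add (M.measurable_X_history h) ?_
  refine Finset.measurable_fun_sum _ fun m hm => ?_
  rw [Finset.mem_Icc] at hm
  exact M.measurable_bonus_history hm.1 hm.2 i

theorem measurable_bonus (m i : ℕ) : Measurable (M.bonus m i) :=
  (M.measurable_bonus_step m i).mono (sup_le (M.stepSigma_le m) (M.measurable_A m).comap_le) le_rfl

theorem measurable_W (n i : ℕ) : Measurable (M.W n i) :=
  (M.measurable_X i).add (Finset.measurable_fun_sum _ fun m _ => M.measurable_bonus m i)

theorem measurable_groupWeight_history {n : ℕ} {s : Finset ℕ} (h : s ⊆ Finset.range (n + 1)) :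
    Measurable[M.history n] (M.groupWeight n s) := by
  refine Finset.measurable_fun_sum _ fun i hi => ?_
  have := Finset.mem_range.1 (h hi)
  exact measurable_from_nat.comp (M.measurable_W_history (by omega : i ≤ n))

theorem measurable_Z_step (n : ℕ) : Measurable[M.stepSigma n] (M.Z n) := by
  have hf : Measurable (fun p : ℕ × (ℕ → ℕ) => ∑ l ∈ Finset.range p.1, p.2 l) :=
    measurable_from_prod_countable_right fun k =>
      Finset.measurable_fun_sum (Finset.range k) fun l _ => measurable_pi_apply l
  have hY : Measurable[M.stepSigma n] (M.Y n) := measurable_iff_comap_le.2 le_sup_right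
  exact hf.comp ((M.measurable_ν_step n).prodMk hY)

theorem measurable_firstBonus (n : ℕ) : Measurable (M.firstBonus n) :=
  (M.measurable_Y_step n 0).mono (M.stepSigma_le n) le_rfl

theorem W_succ (n i : ℕ) (ω : Ω) : M.W (n + 1) i ω = M.W n i ω + M.bonus (n + 1) i ω := by
  rw [W, W, Finset.sum_Icc_succ_top (by omega), add_assoc]

theorem bonus_of_notMem {m i : ℕ} {ω : Ω} (h : i ∉ M.A m ω) : M.bonus m i ω = 0 := if_neg h

theorem sum_bonus {m n : ℕ} {ω : Ω} (h : M.A m ω ⊆ Finset.range n)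
    (hc : (M.A m ω).card = M.ν m ω) : ∑ i ∈ Finset.range n, M.bonus m i ω = M.Z m ω := by
  have : ∀ i ∈ Finset.range n, i ∉ M.A m ω → M.bonus m i ω = 0 := fun i _ hi =>
    M.bonus_of_notMem hi
  rw [← Finset.sum_subset h this, Z, ← hc, ← Finset.sum_rank]
  exact Finset.sum_congr rfl fun i hi => if_pos hi

/-- The number of changes of `ξ` in one step is controlled by the number of authors. -/
theorem abs_ξ_succ_sub_le (n j : ℕ) (ω : Ω) :
    |(M.ξ (n + 1) j ω : ℝ) - M.ξ n j ω| ≤ (M.A (n + 1) ω).card + 1 := by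
  have h : ∀ n, (M.ξ n j ω : ℝ) = ∑ i ∈ Finset.range (n + 1), if M.W n i ω = j then (1 : ℝ) else 0 :=
    fun n => by simp [ξ]
  rw [h, h, Finset.sum_range_succ, add_sub_right_comm, ← Finset.sum_sub_distrib]
  refine (abs_add_le _ _).trans (add_le_add ?_ (by split_ifs <;> simp))
  refine (Finset.abs_sum_le_sum_abs _ _).trans ?_
  calc _ ≤ ∑ i ∈ Finset.range (n + 1), if i ∈ M.A (n + 1) ω then (1 : ℝ) else 0 := by
        refine Finset.sum_le_sum fun i _ => ?_
        by_cases hi : i ∈ M.A (n + 1) ω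
        · rw [if_pos hi]
          split_ifs <;> simp
        · simp [hi, M.W_succ, M.bonus_of_notMem hi]
    _ ≤ _ := by
        rw [← Finset.sum_filter, Finset.filter_mem_eq_inter]
        simpa using Finset.card_le_card Finset.inter_subset_right

section Model

variable {M} {P : Measure Ω}

theorem IsModel.ae_regular (h : M.IsModel P) : ∀ᵐ ω ∂P, (∀ n, 0 < M.X n ω) ∧
    ∀ n, 1 ≤ n → (1 ≤ M.ν n ω ∧ M.ν n ω ≤ n) ∧ M.A n ω ⊆ Finset.range n ∧
      (M.A n ω).card = M.ν n ω := by
  have h1 := ae_all_iff.2 h.X_pos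
  have h2 : ∀ᵐ ω ∂P, ∀ n, 1 ≤ n → 1 ≤ M.ν n ω ∧ M.ν n ω ≤ n :=
    ae_all_iff.2 fun n => by
      by_cases hn : 1 ≤ n
      · filter_upwards [h.ν_bounds n hn] with ω hω _ using hω
      · exact Eventually.of_forall fun ω h => absurd h hn
  have h3 : ∀ᵐ ω ∂P, ∀ n, 1 ≤ n → M.A n ω ⊆ Finset.range n ∧ (M.A n ω).card = M.ν n ω :=
    ae_all_iff.2 fun n => by
      by_cases hn : 1 ≤ n
      · filter_upwards [h.authors n hn] with ω hω _ using hω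
      · exact Eventually.of_forall fun ω h => absurd h hn
  filter_upwards [h1, h2, h3] with ω a b c using ⟨a, fun n hn => ⟨b n hn, c n hn⟩⟩

/-- Authors of papers up to step n have labels below n, so a newcomer has had no chance of a bonus.
-/
theorem IsModel.ae_W_self (h : M.IsModel P) (n : ℕ) : ∀ᵐ ω ∂P, M.W n n ω = M.X n ω := by
  filter_upwards [h.ae_regular] with ω hω
  rw [W, Finset.sum_eq_zero, add_zero]
  intro m hm
  rw [Finset.mem_Icc] at hm
  refine M.bonus_of_notMem fun hn => ?_
  have := Finset.mem_range.1 ((hω.2 m hm.1).2.1 hn)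
  omega

/-- Each paper distributes all of its weight among its authors, so the total does not depend on who
they are. This reduces its growth to laws of large numbers. -/
theorem IsModel.ae_total_weight (h : M.IsModel P) : ∀ᵐ ω ∂P, ∀ n,
    M.groupWeight n (Finset.range (n + 1)) ω =
      ∑ i ∈ Finset.range (n + 1), (M.X i ω : ℝ) + ∑ m ∈ Finset.Icc 1 n, (M.Z m ω : ℝ) := by
  filter_upwards [h.ae_regular] with ω hω n
  have : ∑ i ∈ Finset.range (n + 1), M.W n i ω =
      ∑ i ∈ Finset.range (n + 1), M.X i ω + ∑ m ∈ Finset.Icc 1 n, M.Z m ω := by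
    simp only [W]
    rw [Finset.sum_add_distrib, Finset.sum_comm]
    congr 1
    refine Finset.sum_congr rfl fun m hm => ?_
    rw [Finset.mem_Icc] at hm
    obtain ⟨-, hA, hc⟩ := hω.2 m hm.1
    exact M.sum_bonus (hA.trans (Finset.range_subset_range.2 (by omega))) hc
  rw [groupWeight]
  exact_mod_cast this

end Model

end PublicationProcess

/-! ### Conditional law of one researcher's bonus given the past -/

namespace PublicationProcess

variable {Ω Ω' : Type*} [mΩ : MeasurableSpace Ω] [MeasurableSpace Ω'] {M : PublicationProcess Ω}
  {P : Measure Ω} [IsProbabilityMeasure P] {ν Y Z : Ω' → ℕ} {Q : Measure Ω'}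
  [IsProbabilityMeasure Q]

theorem measurableSet_ν_Y (M : PublicationProcess Ω) (n k r : ℕ) (B : Set ℕ) :
    MeasurableSet[M.stepSigma n] {ω | M.ν n ω = k ∧ M.Y n ω r ∈ B} :=
  MeasurableSet.inter (M.measurable_ν_step n (MeasurableSet.singleton k))
    (M.measurable_Y_step n r (MeasurableSet.of_discrete (s := B)))

/-- The transposition of 0 and r fixes every index from k on because r < k, so exchangeability given
ν = k applies. -/
theorem Assumptions.prob_bonus_eq (h : M.Assumptions P ν Y Z Q) {n k r : ℕ} (hn : 1 ≤ n)
    (hr : r < k) (B : Set ℕ) :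
    P.real {ω | M.ν n ω = k ∧ M.Y n ω r ∈ B} = P.real {ω | M.ν n ω = k ∧ M.Y n ω 0 ∈ B} := by
  have hν : MeasurableSet {ω | M.ν n ω = k} := M.measurable_ν n (MeasurableSet.singleton k)
  by_cases h0 : P {ω | M.ν n ω = k} = 0
  · rw [measureReal_def, measureReal_def, measure_mono_null (fun ω hω => hω.1) h0,
      measure_mono_null (fun ω hω => hω.1) h0]
  have hex := h.Y_exch n k hn h0 (Equiv.swap 0 r) fun l hl =>
    Equiv.swap_apply_of_ne_of_ne (by omega) (by omega)
  have hB : MeasurableSet {y : ℕ → ℕ | y 0 ∈ B} :=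
    measurable_pi_apply 0 (MeasurableSet.of_discrete (s := B))
  have hm : Measurable fun ω l => M.Y n ω (Equiv.swap 0 r l) :=
    measurable_pi_lambda _ fun l => (measurable_pi_apply _).comp (M.measurable_Y n)
  have h1 := congrArg (fun μ => μ {y : ℕ → ℕ | y 0 ∈ B}) hex
  simp only [Measure.map_apply hm hB, Measure.map_apply (M.measurable_Y n) hB,
    cond_apply hν] at h1
  have h2 := (ENNReal.mul_right_inj (ENNReal.inv_ne_zero.2 (measure_ne_top P _))
    (ENNReal.inv_ne_top.2 h0)).1 h1
  simp only [Set.preimage_ofPred_eq, Equiv.swap_apply_left] at h2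
  exact congrArg ENNReal.toReal h2

/-- The selection probability of the group `s` when the number of authors is `s.card`. -/
noncomputable def selectionRatio (M : PublicationProcess Ω) (n : ℕ) (s : Finset ℕ) (ω : Ω) : ℝ :=
  M.groupWeight n s ω /
    ∑ t ∈ Finset.powersetCard s.card (Finset.range (n + 1)), M.groupWeight n t ω

theorem measurable_selectionRatio (M : PublicationProcess Ω) {n : ℕ} {s : Finset ℕ}
    (hs : s ⊆ Finset.range (n + 1)) : Measurable[M.history n] (M.selectionRatio n s) := by
  refine Measurable.div (M.measurable_groupWeight_history hs) ?_
  exact Finset.measurable_fun_sum _ fun t ht =>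
    M.measurable_groupWeight_history (Finset.mem_powersetCard.1 ht).1

theorem norm_selectionRatio_le (M : PublicationProcess Ω) {n : ℕ} {s : Finset ℕ}
    (hs : s ⊆ Finset.range (n + 1)) (ω : Ω) : ‖M.selectionRatio n s ω‖ ≤ 1 := by
  have h0 : ∀ t, 0 ≤ M.groupWeight n t ω := fun t => Finset.sum_nonneg fun i _ => Nat.cast_nonneg _
  rw [selectionRatio, Real.norm_eq_abs, abs_of_nonneg
    (div_nonneg (h0 s) (Finset.sum_nonneg fun t _ => h0 t))]
  refine div_le_one_of_le₀ ?_ (Finset.sum_nonneg fun t _ => h0 t)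
  exact Finset.single_le_sum (f := fun t => M.groupWeight n t ω) (fun t _ => h0 t)
    (Finset.mem_powersetCard.2 ⟨hs, rfl⟩)

/-- Tower property: given the past and the numbers of step n + 1, the selection of s depends on that
step only through ν. The remaining event concerns a step independent of the past, and there rank r
may be replaced by rank 0. -/
theorem condProb_authors_bonus (hM : M.IsModel P) (h : M.Assumptions P ν Y Z Q) (n : ℕ)
    {s : Finset ℕ} (hs : s ⊆ Finset.range (n + 1)) {r : ℕ} (hr : r < s.card) (B : Set ℕ) :
    P⟦{ω | M.A (n + 1) ω = s ∧ M.Y (n + 1) ω r ∈ B} | M.history n⟧ =ᵐ[P] fun ω =>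
      M.selectionRatio n s ω * P.real {ω | M.ν (n + 1) ω = s.card ∧ M.Y (n + 1) ω 0 ∈ B} := by
  have hG : M.history n ⊔ M.stepSigma (n + 1) ≤ mΩ := sup_le (M.history_le n) (M.stepSigma_le _)
  have hA : MeasurableSet {ω | M.A (n + 1) ω = s} := M.measurable_A (n + 1) (MeasurableSet.singleton s)
  have hYG : MeasurableSet[M.history n ⊔ M.stepSigma (n + 1)] {ω | M.Y (n + 1) ω r ∈ B} :=
    (le_sup_right : M.stepSigma (n + 1) ≤ M.history n ⊔ M.stepSigma (n + 1)) _
      (M.measurable_Y_step (n + 1) r (MeasurableSet.of_discrete (s := B)))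
  have hE := M.measurableSet_ν_Y (n + 1) s.card r B
  set E := {ω | M.ν (n + 1) ω = s.card ∧ M.Y (n + 1) ω r ∈ B} with hEdef
  have hi : ∀ {S : Set Ω}, MeasurableSet S → Integrable (S.indicator fun _ => (1 : ℝ)) P :=
    fun hS => (integrable_const _).indicator hS
  have e0 : ({ω | M.A (n + 1) ω = s ∧ M.Y (n + 1) ω r ∈ B}).indicator (fun _ => (1 : ℝ)) =
      ({ω | M.Y (n + 1) ω r ∈ B}).indicator
        (({ω | M.A (n + 1) ω = s}).indicator fun _ => (1 : ℝ)) := by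
    rw [Set.indicator_indicator]
    congr 1
    ext ω
    exact and_comm
  have e1 : P[({ω | M.A (n + 1) ω = s ∧ M.Y (n + 1) ω r ∈ B}).indicator (fun _ => (1 : ℝ)) |
      M.history n ⊔ M.stepSigma (n + 1)] =ᵐ[P]
      M.selectionRatio n s * E.indicator (fun _ => (1 : ℝ)) := by
    rw [e0]
    refine (condExp_indicator (hi hA) hYG).trans ?_
    filter_upwards [hM.selection n s hs] with ω hω
    by_cases hy : M.Y (n + 1) ω r ∈ B
    · rw [Set.indicator_of_mem (show ω ∈ {ω | M.Y (n + 1) ω r ∈ B} from hy), hω, Pi.mul_apply]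
      by_cases hν : M.ν (n + 1) ω = s.card
      · rw [if_pos hν, Set.indicator_of_mem (show ω ∈ E from ⟨hν, hy⟩), mul_one]
        rfl
      · rw [if_neg hν, Set.indicator_of_notMem (fun hm : ω ∈ E => hν hm.1), mul_zero]
    · rw [Set.indicator_of_notMem (show ω ∉ {ω | M.Y (n + 1) ω r ∈ B} from hy), Pi.mul_apply,
        Set.indicator_of_notMem (fun hm : ω ∈ E => hy hm.2), mul_zero]
  have e2 : P[E.indicator (fun _ => (1 : ℝ)) | M.history n] =ᵐ[P] fun _ =>
      P.real {ω | M.ν (n + 1) ω = s.card ∧ M.Y (n + 1) ω 0 ∈ B} := by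
    have := condExp_indep_eq (μ := P) (f := E.indicator fun _ => (1 : ℝ)) (M.stepSigma_le (n + 1))
      (M.history_le n) (stronglyMeasurable_const.indicator hE) (h.step_indep_past n)
    refine this.trans (Eventually.of_forall fun _ => ?_)
    simp only
    rw [integral_indicator_const _ (M.stepSigma_le _ _ hE), smul_eq_mul, mul_one, hEdef,
      h.prob_bonus_eq (by omega) hr]
  refine (condExp_condExp_of_le le_sup_left hG).symm.trans ?_
  refine (condExp_congr_ae e1).trans ?_
  refine (condExp_stronglyMeasurable_mul_of_bound (M.history_le n)
    (M.measurable_selectionRatio hs).stronglyMeasurable (hi (M.stepSigma_le _ _ hE)) 1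
    (Eventually.of_forall (M.norm_selectionRatio_le hs))).trans ?_
  filter_upwards [e2] with ω hω
  rw [Pi.mul_apply, hω]

theorem IsModel.sum_prob_ν_mul (hM : M.IsModel P) {n : ℕ} (hn : 1 ≤ n) (B : Set ℕ) (f : ℕ → ℝ) :
    ∑ k ∈ Finset.range (n + 1), P.real {ω | M.ν n ω = k ∧ M.Y n ω 0 ∈ B} * f k =
      ∫ ω, B.indicator 1 (M.firstBonus n ω) * f (M.ν n ω) ∂P := by
  have hm : ∀ k, MeasurableSet {ω | M.ν n ω = k ∧ M.Y n ω 0 ∈ B} := fun k =>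
    M.stepSigma_le _ _ (M.measurableSet_ν_Y n k 0 B)
  have h1 : (fun ω => B.indicator 1 (M.firstBonus n ω) * f (M.ν n ω)) =ᵐ[P] fun ω =>
      ∑ k ∈ Finset.range (n + 1),
        ({ω | M.ν n ω = k ∧ M.Y n ω 0 ∈ B}).indicator (fun _ => f k) ω := by
    filter_upwards [hM.ν_bounds n hn] with ω hω
    rw [Finset.sum_eq_single_of_mem (M.ν n ω) (Finset.mem_range.2 (by omega))]
    · by_cases hB : M.Y n ω 0 ∈ B
      · rw [Set.indicator_of_mem (show M.firstBonus n ω ∈ B from hB),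
          Set.indicator_of_mem
            (show ω ∈ {ω' | M.ν n ω' = M.ν n ω ∧ M.Y n ω' 0 ∈ B} from ⟨rfl, hB⟩)]
        simp
      · rw [Set.indicator_of_notMem (show M.firstBonus n ω ∉ B from hB),
          Set.indicator_of_notMem (fun h => hB h.2)]
        simp
    · intro k _ hk
      exact Set.indicator_of_notMem (fun h => hk h.1.symm) _
  rw [integral_congr_ae h1, integral_finsetSum _ fun k _ => (integrable_const _).indicator (hm k)]
  refine Finset.sum_congr rfl fun k _ => ?_
  rw [integral_indicator_const _ (hm k), smul_eq_mul]

/-- The expectation of `(ν_n - 1) I(Y_{n,1} ∈ B)`. -/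
noncomputable def excess (M : PublicationProcess Ω) (P : Measure Ω) (n : ℕ) (B : Set ℕ) : ℝ :=
  ∫ ω, B.indicator 1 (M.firstBonus n ω) * ((M.ν n ω : ℝ) - 1) ∂P

/-- The law of the bonus of a given researcher in one step, given the past. -/
theorem condProb_bonus (hM : M.IsModel P) (h : M.Assumptions P ν Y Z Q) {n i : ℕ} (hn : 1 ≤ n)
    (hi : i ≤ n) (B : Set ℕ) (hB : 0 ∉ B) :
    P⟦{ω | M.bonus (n + 1) i ω ∈ B} | M.history n⟧ =ᵐ[P] fun ω =>
      M.W n i ω / M.groupWeight n (Finset.range (n + 1)) ω *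
          (P.real {ω | M.firstBonus (n + 1) ω ∈ B} - M.excess P (n + 1) B / n) +
        M.excess P (n + 1) B / n := by
  classical
  set R := Finset.range (n + 1) with hR
  let rk : Finset ℕ → ℕ := fun s => (s.filter (fun a => a < i)).card
  let pr : ℕ → ℝ := fun k => P.real {ω | M.ν (n + 1) ω = k ∧ M.Y (n + 1) ω 0 ∈ B}
  have hms : ∀ s r, MeasurableSet {ω | M.A (n + 1) ω = s ∧ M.Y (n + 1) ω r ∈ B} := fun s r =>
    (M.measurable_A (n + 1) (MeasurableSet.singleton s)).inter
      (M.stepSigma_le _ _ (M.measurable_Y_step (n + 1) r (MeasurableSet.of_discrete (s := B))))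
  -- Split by the author set s: on A = s the rank of i is a constant. Sets avoiding i contribute
  -- nothing since 0 ∉ B.
  have e1 : ({ω | M.bonus (n + 1) i ω ∈ B}).indicator (fun _ => (1 : ℝ)) =ᵐ[P]
      ∑ s ∈ R.powerset.filter (fun s => i ∈ s),
        ({ω | M.A (n + 1) ω = s ∧ M.Y (n + 1) ω (rk s) ∈ B}).indicator (fun _ => (1 : ℝ)) := by
    filter_upwards [hM.ae_regular] with ω hω
    obtain ⟨-, hA, -⟩ := hω.2 (n + 1) (by omega)
    rw [Finset.sum_apply]
    by_cases hiA : i ∈ M.A (n + 1) ω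
    · rw [Finset.sum_eq_single_of_mem (M.A (n + 1) ω)
        (Finset.mem_filter.2 ⟨Finset.mem_powerset.2 hA, hiA⟩)]
      · simp only [Set.indicator, Set.mem_ofPred_eq, true_and, bonus, if_pos hiA, rk]
      · intro s _ hs
        exact Set.indicator_of_notMem (fun hh => hs hh.1.symm) _
    · rw [Finset.sum_eq_zero, Set.indicator_of_notMem]
      · simpa [M.bonus_of_notMem hiA] using hB
      · intro s hs
        refine Set.indicator_of_notMem (fun hh => hiA ?_) _
        rw [hh.1]
        exact (Finset.mem_filter.1 hs).2
  have e2 : ∀ᵐ ω ∂P, ∀ s ∈ R.powerset.filter (fun s => i ∈ s),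
      P[({ω | M.A (n + 1) ω = s ∧ M.Y (n + 1) ω (rk s) ∈ B}).indicator (fun _ => (1 : ℝ)) |
        M.history n] ω = M.selectionRatio n s ω * pr s.card := by
    rw [Finset.eventually_all]
    intro s hs
    rw [Finset.mem_filter, Finset.mem_powerset] at hs
    refine condProb_authors_bonus hM h n hs.1 ?_ B
    -- The rank of i is below the size of s because i itself is not counted.
    refine Finset.card_lt_card ⟨Finset.filter_subset _ _, fun hh => ?_⟩
    exact lt_irrefl i (Finset.mem_filter.1 (hh hs.2)).2
  refine (condExp_congr_ae e1).trans ((condExp_finsetSum (fun s _ =>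
    (integrable_const _).indicator (hms s _)) _).trans ?_)
  filter_upwards [e2, hM.ae_regular, hM.ae_total_weight] with ω h2 hreg htot
  have hSpos : 0 < M.groupWeight n R ω := by
    rw [hR, htot n]
    refine add_pos_of_pos_of_nonneg ?_ (Finset.sum_nonneg fun _ _ => Nat.cast_nonneg _)
    exact Finset.sum_pos (fun i _ => by exact_mod_cast hreg.1 i) ⟨0, by simp⟩
  have hcard : R.card = n + 1 := Finset.card_range _
  set q := (M.W n i ω : ℝ) / M.groupWeight n R ω with hq
  -- Groups are collected by size k. The size 0 has probability zero because ν ≥ 1, and |R| - 1 = n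
  -- yields the divisor of the excess.
  have e3 : ∀ k ∈ Finset.range (R.card + 1),
      (∑ s ∈ R.powersetCard k, if i ∈ s then M.selectionRatio n s ω * pr s.card else 0) =
        pr k * (q * (1 - ((k : ℝ) - 1) / n) + ((k : ℝ) - 1) / n) := by
    intro k hk
    rcases Nat.eq_zero_or_pos k with rfl | hk0
    · have : pr 0 = 0 := by
        have h0 : P {ω | M.ν (n + 1) ω = 0 ∧ M.Y (n + 1) ω 0 ∈ B} = 0 := by
          refine measure_mono_null (fun ω hω => ?_) (ae_iff.1 (hM.ν_bounds (n + 1) (by omega)))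
          simp only [Set.mem_ofPred_eq] at hω ⊢
          omega
        simp [pr, measureReal_def, h0]
      simp [this]
    · have hkR : k ≤ R.card := by rw [Finset.mem_range] at hk; omega
      have := sum_powersetCard_ratio_of_mem R k (by omega) hk0 hkR (fun l => (M.W n l ω : ℝ))
        hSpos.ne' (i := i) (Finset.mem_range.2 (by omega))
      have h4 : ∀ s ∈ R.powersetCard k,
          (if i ∈ s then M.selectionRatio n s ω * pr s.card else 0) = pr k * (if i ∈ s then
            (∑ l ∈ s, (M.W n l ω : ℝ)) / ∑ t ∈ R.powersetCard k, ∑ l ∈ t, (M.W n l ω : ℝ)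
            else 0) := by
        intro s hs
        have hsk := (Finset.mem_powersetCard.1 hs).2
        split_ifs
        · rw [selectionRatio, hsk, mul_comm]; rfl
        · simp
      rw [Finset.sum_congr rfl h4, ← Finset.mul_sum, this, hcard]
      rw [show ((n + 1 : ℕ) : ℝ) - 1 = n by push_cast; ring]
      simp only [hq, groupWeight]
      ring
  rw [Finset.sum_apply, Finset.sum_congr rfl h2, Finset.sum_filter, Finset.sum_powerset,
    Finset.sum_congr rfl e3, hcard]
  have s1 := hM.sum_prob_ν_mul (n := n + 1) (by omega) B fun _ => 1
  have s2 := hM.sum_prob_ν_mul (n := n + 1) (by omega) B fun k => (k : ℝ) - 1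
  have hp : ∫ ω, B.indicator 1 (M.firstBonus (n + 1) ω) * (1 : ℝ) ∂P =
      P.real {ω | M.firstBonus (n + 1) ω ∈ B} := by
    have : ∀ ω, B.indicator 1 (M.firstBonus (n + 1) ω) * (1 : ℝ) =
        ({ω | M.firstBonus (n + 1) ω ∈ B}).indicator (fun _ => (1 : ℝ)) ω := fun ω => by
      simp [Set.indicator]
    simp_rw [this]
    have hmB : MeasurableSet {ω | M.firstBonus (n + 1) ω ∈ B} :=
      M.measurable_firstBonus (n + 1) (MeasurableSet.of_discrete (s := B))
    rw [integral_indicator_const _ hmB, smul_eq_mul, mul_one]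
  rw [hp] at s1
  rw [← s1, excess, ← s2, Finset.sum_div, ← Finset.sum_sub_distrib, Finset.mul_sum,
    ← Finset.sum_add_distrib]
  refine Finset.sum_congr rfl fun k _ => ?_
  simp only [pr]
  ring

end PublicationProcess

/-! ### Laws of large numbers and the expected change of the counts -/

theorem FiniteMGF.integrable {Ω : Type*} [MeasurableSpace Ω] {V : Ω → ℕ} {P : Measure Ω}
    (h : FiniteMGF V P) (hV : Measurable V) : Integrable (fun ω => (V ω : ℝ)) P := by
  obtain ⟨t, ht, hi⟩ := h
  refine (hi.const_mul t⁻¹).mono' (measurable_from_nat.comp hV).aestronglyMeasurable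
    (Eventually.of_forall fun ω => ?_)
  rw [Real.norm_of_nonneg (Nat.cast_nonneg _), ← div_eq_inv_mul, le_div_iff₀ ht]
  have := Real.add_one_le_exp (t * (V ω : ℝ))
  linarith

theorem integral_indicator_mul_sub_one {Ω : Type*} [MeasurableSpace Ω] {P : Measure Ω}
    [IsProbabilityMeasure P] {V U : Ω → ℕ} {B : Set ℕ} (hU : Measurable U)
    (hV : Integrable (fun ω => (V ω : ℝ)) P) :
    ∫ ω, B.indicator 1 (U ω) * ((V ω : ℝ) - 1) ∂P =
      ∫ ω, B.indicator 1 (U ω) * (V ω : ℝ) ∂P - P.real {ω | U ω ∈ B} := by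
  have hS : MeasurableSet {ω | U ω ∈ B} := hU (MeasurableSet.of_discrete (s := B))
  have e : ∀ f : Ω → ℝ, (fun ω => B.indicator 1 (U ω) * f ω) = ({ω | U ω ∈ B}).indicator f :=
    fun f => by
      ext ω
      by_cases hω : U ω ∈ B
      · rw [Set.indicator_of_mem hω, Set.indicator_of_mem (show ω ∈ {ω | U ω ∈ B} from hω)]; simp
      · rw [Set.indicator_of_notMem hω,
          Set.indicator_of_notMem (show ω ∉ {ω | U ω ∈ B} from hω)]; simp
  rw [e fun ω => (V ω : ℝ) - 1, e fun ω => (V ω : ℝ), integral_indicator hS,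
    integral_indicator hS, integral_sub hV.integrableOn (integrable_const _).integrableOn]
  simp

/-- The change of the indicator of the weight `j` when the positive weight `w` grows by `b`. -/
theorem ite_add_eq_sub_ite_eq {w : ℕ} (hw : 0 < w) (b j : ℕ) :
    (if w + b = j then (1 : ℝ) else 0) - (if w = j then 1 else 0) =
      ∑ l ∈ Finset.Icc 1 (j - 1), (if w = j - l ∧ b = l then (1 : ℝ) else 0) -
        if w = j ∧ b ≠ 0 then 1 else 0 := by
  by_cases hb : b ∈ Finset.Icc 1 (j - 1)
  · rw [Finset.sum_eq_single_of_mem b hb fun l _ hl => if_neg fun hh => hl hh.2.symm]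
    rw [Finset.mem_Icc] at hb
    have : w + b = j ↔ w = j - b := by omega
    have hb0 : b ≠ 0 := by omega
    simp [this, hb0]
  · rw [Finset.sum_eq_zero fun l hl => if_neg fun hh : w = j - l ∧ b = l => hb (hh.2 ▸ hl)]
    rw [Finset.mem_Icc] at hb
    by_cases hb0 : b = 0
    · simp [hb0]
    -- Here b ≥ j, and w is positive, so the new weight exceeds j.
    · have : w + b ≠ j := by omega
      simp [this, hb0]

namespace PublicationProcess

variable {Ω Ω' : Type*} [mΩ : MeasurableSpace Ω] [MeasurableSpace Ω'] {M : PublicationProcess Ω}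
  {P : Measure Ω} [IsProbabilityMeasure P] {ν Y Z : Ω' → ℕ} {Q : Measure Ω'}
  [IsProbabilityMeasure Q]

theorem Assumptions.tendsto_average_X (h : M.Assumptions P ν Y Z Q) :
    ∀ᵐ ω ∂P, Tendsto (fun n : ℕ => (∑ i ∈ Finset.range n, (M.X i ω : ℝ)) / n) atTop
      (𝓝 (∫ ω, (M.X 0 ω : ℝ) ∂P)) := by
  have hc : Measurable (fun k : ℕ => (k : ℝ)) := measurable_from_nat
  exact strong_law_ae_real (fun i ω => (M.X i ω : ℝ)) (h.X_mgf.integrable (M.measurable_X 0))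
    (fun i j hij => (h.X_indep.indepFun hij).comp hc hc) (fun i => (h.X_ident i).comp hc)

/-- The Z_n need not be identically distributed. The centred variables divided by n are martingale
differences with summable variances, so their series converges almost surely, and Kronecker's lemma
applies. -/
theorem Assumptions.tendsto_average_Z (h : M.Assumptions P ν Y Z Q) :
    ∀ᵐ ω ∂P, Tendsto (fun n : ℕ => (∑ m ∈ Finset.Icc 1 n, (M.Z m ω : ℝ)) / n) atTop
      (𝓝 (∫ ω, (Z ω : ℝ) ∂Q)) := by
  let c : ℕ → ℝ := fun n => ∫ ω, (M.Z (n + 1) ω : ℝ) ∂P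
  let g : ℕ → Ω → ℝ := fun n ω => ((M.Z (n + 1) ω : ℝ) - c n) / (n + 1)
  have hL : ∀ n, MemLp (fun ω => (M.Z (n + 1) ω : ℝ)) 2 P := fun n => h.Z_memLp (n + 1) (by omega)
  have hgL : ∀ n, MemLp (g n) 2 P := fun n => by
    have := ((hL n).sub (memLp_const (c n))).const_mul ((n : ℝ) + 1)⁻¹
    refine this.ae_eq (Eventually.of_forall fun ω => ?_)
    simp only [g, Pi.sub_apply]; ring
  have hgm : ∀ n, Measurable[M.stepSigma (n + 1)] (g n) := fun n =>
    ((measurable_from_nat.comp (M.measurable_Z_step (n + 1)) :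
      Measurable[M.stepSigma (n + 1)] fun ω => (M.Z (n + 1) ω : ℝ)).sub_const _).div_const _
  have hs : ∀ n, M.stepSigma (n + 1) ≤ M.history (n + 1) := fun n =>
    le_sup_left.trans (M.step_le_history (by omega) le_rfl)
  have key := ae_exists_tendsto_sum_of_martingale_difference M.historyFiltration (g := g) (P := P)
    (fun n => ((hgm n).mono (hs n) le_rfl).stronglyMeasurable) hgL ?_ ?_
  · filter_upwards [key] with ω hω
    obtain ⟨T, hT⟩ := hω
    have h1 := tendsto_average_zero_of_tendsto_sum_div (d := fun k => (M.Z (k + 1) ω : ℝ) - c k) hT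
    have h2 := h1.add h.tendsto_Z
    rw [zero_add] at h2
    refine h2.congr fun n => ?_
    have e : ∀ f : ℕ → ℝ, ∑ m ∈ Finset.Icc 1 n, f m = ∑ k ∈ Finset.range n, f (k + 1) := fun f => by
      rw [Finset.range_eq_Ico, Finset.sum_Ico_add' f 0 n 1]
      rfl
    rw [e, e, ← add_div, Finset.sum_sub_distrib, sub_add_cancel]
  · intro n
    have h1 := condExp_indep_eq (μ := P) (M.stepSigma_le (n + 1)) (M.history_le n)
      (hgm n).stronglyMeasurable (h.step_indep_past n)
    refine h1.trans (Eventually.of_forall fun ω => ?_)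
    simp only [g, Pi.zero_apply]
    rw [integral_div, integral_sub ((hL n).integrable one_le_two) (integrable_const _)]
    simp [c]
  · refine h.Z_var_summable.congr fun n => ?_
    rw [variance_eq_integral (hL n).aestronglyMeasurable.aemeasurable, ← integral_div]
    simp only [g, div_pow]
    rfl

theorem IsModel.tendsto_total_weight (hM : M.IsModel P) (h : M.Assumptions P ν Y Z Q) :
    ∀ᵐ ω ∂P, Tendsto (fun n : ℕ => M.groupWeight n (Finset.range (n + 1)) ω / n) atTop
      (𝓝 (∫ ω, (M.X 0 ω : ℝ) ∂P + ∫ ω, (Z ω : ℝ) ∂Q)) := by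
  filter_upwards [hM.ae_total_weight, h.tendsto_average_X, h.tendsto_average_Z] with ω h1 h2 h3
  have h4 : Tendsto (fun n : ℕ => (n : ℝ) / (n + 1)) atTop (𝓝 1) := tendsto_natCast_div_add_atTop 1
  have h5 := (((tendsto_add_atTop_iff_nat 1).2 h2).div h4 one_ne_zero).add h3
  rw [div_one] at h5
  refine h5.congr' ?_
  filter_upwards [eventually_gt_atTop 0] with n hn
  have hn' : (n : ℝ) ≠ 0 := by positivity
  simp only [Pi.div_apply]
  rw [h1 n]
  push_cast
  field_simp

theorem Assumptions.tendsto_prob_firstBonus (h : M.Assumptions P ν Y Z Q) (hY : Measurable Y)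
    (B : Set ℕ) :
    Tendsto (fun n => P.real {ω | M.firstBonus (n + 1) ω ∈ B}) atTop
      (𝓝 (Q.real {ω | Y ω ∈ B})) := by
  have h1 := tendsto_integral_of_tendstoInDistribution h.tendsto_law
    (fun e => B.indicator 1 e.2.1) 1 fun e => by
      by_cases he : e.2.1 ∈ B <;> simp [he]
  have hB : MeasurableSet B := MeasurableSet.of_discrete
  have e1 : ∀ n, ∫ ω, B.indicator (1 : ℕ → ℝ) (M.firstBonus n ω) ∂P =
      P.real {ω | M.firstBonus n ω ∈ B} := fun n =>
    integral_indicator_one (s := {ω | M.firstBonus n ω ∈ B}) (M.measurable_firstBonus n hB)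
  have e2 : ∫ ω, B.indicator (1 : ℕ → ℝ) (Y ω) ∂Q = Q.real {ω | Y ω ∈ B} :=
    integral_indicator_one (s := {ω | Y ω ∈ B}) (hY hB)
  simp only [e1, e2] at h1
  exact (tendsto_add_atTop_iff_nat 1).2 h1

theorem IsModel.memLp_ν (hM : M.IsModel P) {n : ℕ} (hn : 1 ≤ n) (p : ENNReal) :
    MemLp (fun ω => (M.ν n ω : ℝ)) p P := by
  refine MemLp.of_bound (measurable_from_nat.comp (M.measurable_ν n)).aestronglyMeasurable n ?_
  filter_upwards [hM.ν_bounds n hn] with ω hω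
  rw [Real.norm_of_nonneg (Nat.cast_nonneg _)]
  exact_mod_cast hω.2

/-- The limit ν may be unbounded, so convergence in law is combined with E ν_n → E ν. -/
theorem IsModel.tendsto_excess (hM : M.IsModel P) (h : M.Assumptions P ν Y Z Q)
    (hν : Measurable ν) (hY : Measurable Y) (hZ : Measurable Z) (B : Set ℕ) :
    Tendsto (fun n => M.excess P (n + 1) B) atTop (𝓝 (excessOn ν Q {ω | Y ω ∈ B})) := by
  have hmZ : ∀ n, Measurable (M.Z n) := fun n => (M.measurable_Z_step n).mono (M.stepSigma_le n) le_rfl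
  have h1 := tendsto_integral_mul_of_tendstoInDistribution
    (fun n => (M.measurable_ν n).prodMk ((M.measurable_firstBonus n).prodMk (hmZ n)))
    (hν.prodMk (hY.prodMk hZ)) h.tendsto_law (fun e => e.1) (fun e => B.indicator 1 e.2.1)
    (fun e => Set.indicator_nonneg (fun _ _ => zero_le_one) _)
    (fun e => Set.indicator_le_self' (fun _ _ => zero_le_one) _)
    (by
      filter_upwards [eventually_ge_atTop 1] with n hn
      exact (hM.memLp_ν hn 1).integrable le_rfl) h.ν_integrable h.tendsto_ν
  have h2 := h.tendsto_prob_firstBonus hY B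
  have h3 := ((tendsto_add_atTop_iff_nat 1).2 h1).sub h2
  have eQ : excessOn ν Q {ω | Y ω ∈ B} =
      ∫ ω, B.indicator 1 (Y ω) * ((ν ω : ℝ) - 1) ∂Q := by
    refine integral_congr_ae (Eventually.of_forall fun ω => ?_)
    by_cases hω : Y ω ∈ B
    · simp only
      rw [Set.indicator_of_mem hω, Set.indicator_of_mem (show ω ∈ {ω | Y ω ∈ B} from hω)]; simp
    · simp only
      rw [Set.indicator_of_notMem hω,
        Set.indicator_of_notMem (show ω ∉ {ω | Y ω ∈ B} from hω)]; simp
  rw [eQ, integral_indicator_mul_sub_one hY h.ν_integrable]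
  refine h3.congr fun n => ?_
  rw [excess, integral_indicator_mul_sub_one (M.measurable_firstBonus (n + 1))
    ((hM.memLp_ν (by omega) 1).integrable le_rfl)]

/-- The conditional probability that a researcher of weight `w` receives in step `n + 1` a bonus
belonging to `B`. -/
noncomputable def bonusRate (M : PublicationProcess Ω) (P : Measure Ω) (n w : ℕ) (B : Set ℕ)
    (ω : Ω) : ℝ :=
  w / M.groupWeight n (Finset.range (n + 1)) ω *
      (P.real {ω | M.firstBonus (n + 1) ω ∈ B} - M.excess P (n + 1) B / n) +
    M.excess P (n + 1) B / n

theorem condProb_weight_bonus (hM : M.IsModel P) (h : M.Assumptions P ν Y Z Q) {n i : ℕ}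
    (hn : 1 ≤ n) (hi : i ≤ n) (w : ℕ) (B : Set ℕ) (hB : 0 ∉ B) :
    P⟦{ω | M.W n i ω = w ∧ M.bonus (n + 1) i ω ∈ B} | M.history n⟧ =ᵐ[P]
      ({ω | M.W n i ω = w}).indicator (M.bonusRate P n w B) := by
  have hW : MeasurableSet[M.history n] {ω | M.W n i ω = w} :=
    M.measurable_W_history hi (MeasurableSet.singleton w)
  have hb : MeasurableSet {ω | M.bonus (n + 1) i ω ∈ B} :=
    M.measurable_bonus (n + 1) i (MeasurableSet.of_discrete (s := B))
  have e0 : ({ω | M.W n i ω = w ∧ M.bonus (n + 1) i ω ∈ B}).indicator (fun _ => (1 : ℝ)) =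
      ({ω | M.W n i ω = w}).indicator
        (({ω | M.bonus (n + 1) i ω ∈ B}).indicator fun _ => (1 : ℝ)) := by
    rw [Set.indicator_indicator]; rfl
  rw [e0]
  refine (condExp_indicator ((integrable_const _).indicator hb) hW).trans ?_
  filter_upwards [condProb_bonus hM h hn hi B hB] with ω hω
  by_cases hw : M.W n i ω = w
  · rw [Set.indicator_of_mem (show ω ∈ {ω | M.W n i ω = w} from hw),
      Set.indicator_of_mem (show ω ∈ {ω | M.W n i ω = w} from hw), hω, bonusRate, hw]
  · rw [Set.indicator_of_notMem (show ω ∉ {ω | M.W n i ω = w} from hw),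
      Set.indicator_of_notMem (show ω ∉ {ω | M.W n i ω = w} from hw)]

theorem Assumptions.condProb_X (h : M.Assumptions P ν Y Z Q) (n j : ℕ) :
    P⟦{ω | M.X (n + 1) ω = j} | M.history n⟧ =ᵐ[P] fun _ => P.real {ω | M.X 0 ω = j} := by
  have hm : MeasurableSet[MeasurableSpace.comap (M.X (n + 1)) inferInstance]
      {ω | M.X (n + 1) ω = j} := ⟨{j}, MeasurableSet.singleton j, rfl⟩
  have h1 := condExp_indep_eq (μ := P) (f := ({ω | M.X (n + 1) ω = j}).indicator fun _ => (1 : ℝ))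
    (M.measurable_X (n + 1)).comap_le (M.history_le n) (stronglyMeasurable_const.indicator hm)
    (indep_of_indep_of_le_right (h.X_indep_past n) le_sup_left)
  refine h1.trans (Eventually.of_forall fun _ => ?_)
  simp only
  rw [integral_indicator_const _ ((M.measurable_X (n + 1)).comap_le _ hm), smul_eq_mul, mul_one]
  exact congrArg ENNReal.toReal ((h.X_ident (n + 1)).measure_mem_eq (MeasurableSet.singleton j))

theorem ξ_eq_sum (M : PublicationProcess Ω) (n j : ℕ) (ω : Ω) : (M.ξ n j ω : ℝ) =
    ∑ i ∈ Finset.range (n + 1), ({ω | M.W n i ω = j}).indicator (fun _ => (1 : ℝ)) ω := by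
  simp [ξ, Set.indicator]

theorem measurable_ξ_history (M : PublicationProcess Ω) (n j : ℕ) :
    Measurable[M.history n] fun ω => (M.ξ n j ω : ℝ) := by
  simp only [ξ_eq_sum]
  refine Finset.measurable_fun_sum _ fun i hi => measurable_const.indicator ?_
  rw [Finset.mem_range] at hi
  exact M.measurable_W_history (by omega : i ≤ n) (MeasurableSet.singleton j)

theorem memLp_ξ (M : PublicationProcess Ω) (P : Measure Ω) [IsProbabilityMeasure P] (n j : ℕ) :
    MemLp (fun ω => (M.ξ n j ω : ℝ)) 2 P := by
  refine MemLp.of_bound ((M.measurable_ξ_history n j).mono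
    (M.history_le n) le_rfl).aestronglyMeasurable (n + 1) (Eventually.of_forall fun ω => ?_)
  rw [Real.norm_of_nonneg (Nat.cast_nonneg _)]
  have : M.ξ n j ω ≤ n + 1 := (Finset.card_filter_le _ _).trans_eq (Finset.card_range _)
  exact_mod_cast this

/-- The conditional rate of a bonus depends on a researcher only through the current weight. Summing
over researchers therefore turns indicators into counts ξ times rates. -/
theorem condExp_ξ_increment (hM : M.IsModel P) (h : M.Assumptions P ν Y Z Q) {n : ℕ}
    (hn : 1 ≤ n) (j : ℕ) :
    P[fun ω => (M.ξ (n + 1) j ω : ℝ) - M.ξ n j ω | M.history n] =ᵐ[P] fun ω =>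
      ∑ l ∈ Finset.Icc 1 (j - 1), (M.ξ n (j - l) ω : ℝ) * M.bonusRate P n (j - l) {l} ω
        - M.ξ n j ω * M.bonusRate P n j {0}ᶜ ω + P.real {ω | M.X 0 ω = j} := by
  let gain : ℕ → ℕ → Ω → ℝ := fun i l =>
    ({ω | M.W n i ω = j - l ∧ M.bonus (n + 1) i ω ∈ ({l} : Set ℕ)}).indicator fun _ => (1 : ℝ)
  let loss : ℕ → Ω → ℝ := fun i =>
    ({ω | M.W n i ω = j ∧ M.bonus (n + 1) i ω ∈ ({0}ᶜ : Set ℕ)}).indicator fun _ => (1 : ℝ)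
  let new : Ω → ℝ := ({ω | M.X (n + 1) ω = j}).indicator fun _ => (1 : ℝ)
  have hms : ∀ i w (B : Set ℕ), MeasurableSet {ω | M.W n i ω = w ∧ M.bonus (n + 1) i ω ∈ B} :=
    fun i w B => (M.measurable_W n i (MeasurableSet.singleton w)).inter
      (M.measurable_bonus (n + 1) i (MeasurableSet.of_discrete (s := B)))
  have hi : ∀ {S : Set Ω}, MeasurableSet S → Integrable (S.indicator fun _ => (1 : ℝ)) P :=
    fun hS => (integrable_const _).indicator hS
  have e1 : (fun ω => (M.ξ (n + 1) j ω : ℝ) - M.ξ n j ω) =ᵐ[P]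
      ∑ i ∈ Finset.range (n + 1), (∑ l ∈ Finset.Icc 1 (j - 1), gain i l - loss i) + new := by
    filter_upwards [hM.ae_regular, hM.ae_W_self (n + 1)] with ω hreg hself
    rw [ξ_eq_sum, ξ_eq_sum, Finset.sum_range_succ, add_sub_right_comm, ← Finset.sum_sub_distrib,
      Pi.add_apply, Finset.sum_apply]
    congr 1
    · refine Finset.sum_congr rfl fun i _ => ?_
      have hpos : 0 < M.W n i ω := Nat.add_pos_left (hreg.1 i) _
      rw [Pi.sub_apply, Finset.sum_apply]
      simp only [gain, loss, Set.indicator, Set.mem_ofPred_eq, Set.mem_singleton_iff,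
        Set.mem_compl_iff, M.W_succ]
      convert ite_add_eq_sub_ite_eq hpos (M.bonus (n + 1) i ω) j
    · simp only [new, Set.indicator, Set.mem_ofPred_eq, hself]
      congr
  have hgain : ∀ i l, Integrable (gain i l) P := fun i l => hi (hms _ _ _)
  have hloss : ∀ i, Integrable (loss i) P := fun i => hi (hms _ _ _)
  have hgs : ∀ i, Integrable (∑ l ∈ Finset.Icc 1 (j - 1), gain i l) P := fun i =>
    integrable_finsetSum' _ fun l _ => hgain i l
  have hnew : Integrable new P := hi (M.measurable_X (n + 1) (MeasurableSet.singleton j))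
  have c1 := condExp_add (integrable_finsetSum' (Finset.range (n + 1)) fun i _ =>
    (hgs i).sub (hloss i)) hnew (M.history n)
  have c2 := condExp_finsetSum (s := Finset.range (n + 1)) (fun i _ => (hgs i).sub (hloss i))
    (M.history n)
  have c3 : ∀ᵐ ω ∂P, ∀ i ∈ Finset.range (n + 1),
      P[∑ l ∈ Finset.Icc 1 (j - 1), gain i l - loss i | M.history n] ω =
        ∑ l ∈ Finset.Icc 1 (j - 1),
          ({ω | M.W n i ω = j - l}).indicator (M.bonusRate P n (j - l) {l}) ω -
        ({ω | M.W n i ω = j}).indicator (M.bonusRate P n j {0}ᶜ) ω := by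
    rw [Finset.eventually_all]
    intro i hin
    rw [Finset.mem_range] at hin
    have d1 := condExp_sub (hgs i) (hloss i) (M.history n)
    have d2 := condExp_finsetSum (s := Finset.Icc 1 (j - 1)) (fun l _ => hgain i l) (M.history n)
    have d3 : ∀ᵐ ω ∂P, ∀ l ∈ Finset.Icc 1 (j - 1), P[gain i l | M.history n] ω =
        ({ω | M.W n i ω = j - l}).indicator (M.bonusRate P n (j - l) {l}) ω := by
      rw [Finset.eventually_all]
      intro l hl
      rw [Finset.mem_Icc] at hl
      refine condProb_weight_bonus hM h hn (by omega) (j - l) {l} ?_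
      rw [Set.mem_singleton_iff]
      omega
    have d4 := condProb_weight_bonus hM h hn (by omega : i ≤ n) j {0}ᶜ (by simp)
    filter_upwards [d1, d2, d3, d4] with ω h1 h2 h3 h4
    rw [h1, Pi.sub_apply, h2, Finset.sum_apply, Finset.sum_congr rfl h3, h4]
  refine (condExp_congr_ae e1).trans (c1.trans ?_)
  filter_upwards [c2, c3, h.condProb_X n j] with ω h2 h3 h4
  rw [Pi.add_apply, h2, Finset.sum_apply, Finset.sum_congr rfl h3, h4, Finset.sum_sub_distrib,
    Finset.sum_comm]
  have e : ∀ w (r : Ω → ℝ), ∑ i ∈ Finset.range (n + 1), ({ω | M.W n i ω = w}).indicator r ω =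
      M.ξ n w ω * r ω := fun w r => by
    rw [ξ_eq_sum, Finset.sum_mul]
    exact Finset.sum_congr rfl fun i _ => by simp [Set.indicator]
  simp only [e]

end PublicationProcess

/-! ### Almost sure convergence for a fixed weight -/

namespace PublicationProcess

variable {Ω Ω' : Type*} [mΩ : MeasurableSpace Ω] [MeasurableSpace Ω'] {M : PublicationProcess Ω}
  {P : Measure Ω} [IsProbabilityMeasure P] {ν Y Z : Ω' → ℕ} {Q : Measure Ω'}
  [IsProbabilityMeasure Q]

/-- An increment is at most ν + 1 ≤ 2ν in absolute value and E ν_n² is bounded, so after division by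
k + 1 the second moments are summable. -/
theorem ae_tendsto_sum_centred_ξ_increment (hM : M.IsModel P) (h : M.Assumptions P ν Y Z Q)
    (j : ℕ) :
    ∀ᵐ ω ∂P, ∃ T, Tendsto (fun n => ∑ k ∈ Finset.range n,
      ((M.ξ (k + 1) j ω : ℝ) - M.ξ k j ω -
        P[fun ω => (M.ξ (k + 1) j ω : ℝ) - M.ξ k j ω | M.history k] ω) / ((k : ℝ) + 1))
      atTop (𝓝 T) := by
  let f : ℕ → Ω → ℝ := fun k ω => (M.ξ (k + 1) j ω : ℝ) - M.ξ k j ω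
  have hf : ∀ k, MemLp (f k) 2 P := fun k => (M.memLp_ξ P (k + 1) j).sub (M.memLp_ξ P k j)
  have hfm : ∀ k, Measurable[M.history (k + 1)] (f k) := fun k =>
    (M.measurable_ξ_history (k + 1) j).sub
      ((M.measurable_ξ_history k j).mono (M.history_mono (Nat.le_succ k)) le_rfl)
  have hfi : ∀ k, Integrable (f k) P := fun k => (hf k).integrable one_le_two
  let D : ℕ → Ω → ℝ := fun k => f k - P[f k | M.history k]
  have hD : ∀ k, MemLp (D k) 2 P := fun k => (hf k).sub ((hf k).condExp one_le_two)
  have hDm : ∀ k, StronglyMeasurable[M.history (k + 1)] (D k) := fun k =>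
    (hfm k).stronglyMeasurable.sub
      (stronglyMeasurable_condExp.mono (M.history_mono (Nat.le_succ k)))
  obtain ⟨C, hC⟩ := h.tendsto_ν_sq.bddAbove_range
  have hbound : ∀ k, ∫ ω, f k ω ^ 2 ∂P ≤ 4 * C := fun k => by
    have hν := (hM.memLp_ν (n := k + 1) (by omega) 2).integrable_sq
    calc ∫ ω, f k ω ^ 2 ∂P ≤ ∫ ω, 4 * (M.ν (k + 1) ω : ℝ) ^ 2 ∂P := by
          refine integral_mono_ae (hf k).integrable_sq (hν.const_mul 4) ?_
          filter_upwards [hM.ae_regular] with ω hω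
          obtain ⟨⟨h1, -⟩, -, hc⟩ := hω.2 (k + 1) (by omega)
          have h2 := M.abs_ξ_succ_sub_le k j ω
          rw [hc] at h2
          have h1' : (1 : ℝ) ≤ M.ν (k + 1) ω := by exact_mod_cast h1
          have h3 : |f k ω| ≤ 2 * M.ν (k + 1) ω := h2.trans (by linarith)
          calc f k ω ^ 2 = |f k ω| ^ 2 := (sq_abs _).symm
            _ ≤ (2 * (M.ν (k + 1) ω : ℝ)) ^ 2 := by gcongr
            _ = 4 * (M.ν (k + 1) ω : ℝ) ^ 2 := by ring
      _ = 4 * ∫ ω, (M.ν (k + 1) ω : ℝ) ^ 2 ∂P := integral_const_mul _ _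
      _ ≤ 4 * C := by gcongr; exact hC ⟨k + 1, rfl⟩
  refine ae_exists_tendsto_sum_of_martingale_difference M.historyFiltration
    (g := fun k ω => D k ω / ((k : ℝ) + 1)) (fun k => ?_) (fun k => ?_) (fun k => ?_) ?_
  · exact (hDm k).div stronglyMeasurable_const
  · simp only [div_eq_mul_inv]
    exact (hD k).mul_const _
  · have e : (fun ω => D k ω / ((k : ℝ) + 1)) = ((k : ℝ) + 1)⁻¹ • D k := by
      ext ω
      simp only [Pi.smul_apply, smul_eq_mul]
      ring
    rw [e]
    have c1 := condExp_smul (μ := P) ((k : ℝ) + 1)⁻¹ (D k) (M.history k)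
    have c2 : P[D k | M.history k] =ᵐ[P] P[f k | M.history k] - P[P[f k | M.history k] | M.history k] :=
      condExp_sub (hfi k) integrable_condExp (M.history k)
    have c3 : P[P[f k | M.history k] | M.history k] = P[f k | M.history k] :=
      condExp_of_stronglyMeasurable (M.history_le k) stronglyMeasurable_condExp integrable_condExp
    refine c1.trans ?_
    filter_upwards [c2] with ω hω
    rw [Pi.smul_apply, hω, c3]
    simp
  · have hs : Summable fun k : ℕ => 4 * C * (1 / ((k : ℝ) + 1) ^ 2) := by
      refine Summable.mul_left _ ?_
      have := (summable_nat_add_iff 1).2 (Real.summable_one_div_nat_pow.2 one_lt_two)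
      simpa using this
    refine hs.of_nonneg_of_le (fun k => integral_nonneg fun ω => sq_nonneg _) fun k => ?_
    simp only [div_pow]
    rw [integral_div, div_eq_mul_one_div]
    gcongr
    exact (integral_sq_sub_condExp_le (M.history_le k) (hf k)).trans (hbound k)

omit [IsProbabilityMeasure P] in
-- The excess over n is negligible beside the first bonus probability, but the separate summant of
-- that order survives multiplication by n.
theorem tendsto_mul_bonusRate {w : ℕ} {B : Set ℕ} {ω : Ω} {m p e : ℝ} (hm : m ≠ 0)
    (hS : Tendsto (fun n : ℕ => M.groupWeight n (Finset.range (n + 1)) ω / n) atTop (𝓝 m))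
    (hp : Tendsto (fun n => P.real {ω | M.firstBonus (n + 1) ω ∈ B}) atTop (𝓝 p))
    (he : Tendsto (fun n => M.excess P (n + 1) B) atTop (𝓝 e)) :
    Tendsto (fun n : ℕ => (n : ℝ) * M.bonusRate P n w B ω) atTop (𝓝 (w * p / m + e)) := by
  have h1 : Tendsto (fun n : ℕ => M.excess P (n + 1) B / n) atTop (𝓝 0) :=
    he.div_atTop tendsto_natCast_atTop_atTop
  have h2 := (((hp.sub h1).const_mul (w : ℝ)).div hS hm).add he
  rw [sub_zero] at h2
  refine h2.congr' ?_
  filter_upwards [eventually_gt_atTop 0] with n hn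
  have hn' : (n : ℝ) ≠ 0 := by positivity
  simp only [Pi.div_apply, bonusRate]
  field_simp

/-- One step of the induction on the weight: convergence of the proportions of the smaller weights
gives the convergence for the weight `j`. -/
theorem ae_tendsto_ξ_div (hM : M.IsModel P) (h : M.Assumptions P ν Y Z Q)
    (hν : Measurable ν) (hY : Measurable Y) (hZ : Measurable Z) {m : ℝ}
    (hm : m = ∫ ω, (M.X 0 ω : ℝ) ∂P + ∫ ω, (Z ω : ℝ) ∂Q) (hm0 : 0 < m)
    (hβ : 0 ≤ excessOn ν Q {ω | 0 < Y ω}) (j : ℕ) (x : ℕ → ℝ)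
    (hx : ∀ l ∈ Finset.Icc 1 (j - 1), ∀ᵐ ω ∂P,
      Tendsto (fun n : ℕ => (M.ξ n (j - l) ω : ℝ) / n) atTop (𝓝 (x (j - l)))) :
    ∀ᵐ ω ∂P, Tendsto (fun n : ℕ => (M.ξ n j ω : ℝ) / n) atTop
      (𝓝 ((∑ l ∈ Finset.Icc 1 (j - 1), x (j - l) *
          (((j - l : ℕ) : ℝ) * Q.real {ω | Y ω = l} / m + excessOn ν Q {ω | Y ω = l}) +
        P.real {ω | M.X 0 ω = j}) /
      (j * Q.real {ω | 0 < Y ω} / m + excessOn ν Q {ω | 0 < Y ω} + 1))) := by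
  have hcond : ∀ᵐ ω ∂P, ∀ n, 1 ≤ n →
      P[fun ω => (M.ξ (n + 1) j ω : ℝ) - M.ξ n j ω | M.history n] ω =
      ∑ l ∈ Finset.Icc 1 (j - 1), (M.ξ n (j - l) ω : ℝ) * M.bonusRate P n (j - l) {l} ω
        - M.ξ n j ω * M.bonusRate P n j {0}ᶜ ω + P.real {ω | M.X 0 ω = j} := by
    refine ae_all_iff.2 fun n => ?_
    by_cases hn : 1 ≤ n
    · filter_upwards [condExp_ξ_increment hM h hn j] with ω hω _ using hω
    · exact Eventually.of_forall fun ω hh => absurd hh hn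
  have hpos : {ω | Y ω ∈ ({0}ᶜ : Set ℕ)} = {ω | 0 < Y ω} := by
    ext ω
    simp [Nat.pos_iff_ne_zero]
  filter_upwards [hcond, ae_tendsto_sum_centred_ξ_increment hM h j, hM.tendsto_total_weight h,
    (Finset.eventually_all _).2 hx] with ω h1 h2 h3 h4
  obtain ⟨T, hT⟩ := h2
  rw [← hm] at h3
  have hrate : ∀ w (B : Set ℕ), Tendsto (fun n : ℕ => (n : ℝ) * M.bonusRate P n w B ω) atTop
      (𝓝 (w * Q.real {ω | Y ω ∈ B} / m + excessOn ν Q {ω | Y ω ∈ B})) := fun w B =>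
    tendsto_mul_bonusRate hm0.ne' h3 (h.tendsto_prob_firstBonus hY B)
      (hM.tendsto_excess h hν hY hZ B)
  have hr : Tendsto (fun n : ℕ => (n : ℝ) / (n + 1)) atTop (𝓝 1) := tendsto_natCast_div_add_atTop 1
  -- The factor is n + 1 rather than n to match u n/(n+1) in the deterministic recursion.
  have hu : Tendsto (fun n : ℕ => ((n : ℝ) + 1) * M.bonusRate P n j {0}ᶜ ω) atTop
      (𝓝 (j * Q.real {ω | 0 < Y ω} / m + excessOn ν Q {ω | 0 < Y ω})) := by
    have := (hrate j {0}ᶜ).div hr one_ne_zero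
    rw [hpos, div_one] at this
    refine this.congr' ?_
    filter_upwards [eventually_gt_atTop 0] with n hn
    have hn' : (n : ℝ) ≠ 0 := by positivity
    simp only [Pi.div_apply]
    field_simp
  have hv : Tendsto (fun n : ℕ => ∑ l ∈ Finset.Icc 1 (j - 1),
      (M.ξ n (j - l) ω : ℝ) * M.bonusRate P n (j - l) {l} ω + P.real {ω | M.X 0 ω = j}) atTop
      (𝓝 (∑ l ∈ Finset.Icc 1 (j - 1), x (j - l) *
          (((j - l : ℕ) : ℝ) * Q.real {ω | Y ω = l} / m + excessOn ν Q {ω | Y ω = l}) +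
        P.real {ω | M.X 0 ω = j})) := by
    refine (tendsto_finsetSum _ fun l hl => ?_).add_const _
    refine ((h4 l hl).mul (hrate (j - l) {l})).congr' ?_
    filter_upwards [eventually_gt_atTop 0] with n hn
    have hn' : (n : ℝ) ≠ 0 := by positivity
    field_simp
  refine tendsto_div_of_perturbed_recursion ?_ hu hv hT ?_
  · positivity
  · filter_upwards [eventually_ge_atTop 1] with n hn
    rw [h1 n hn]
    have hn' : (n : ℝ) + 1 ≠ 0 := by positivity
    field_simp
    ring

end PublicationProcess

/-! ### The limiting recursion and attainable weights -/

/-- The solution of a linear recursion over the smaller positive indices. -/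
noncomputable def weightDensity (c : ℕ → ℕ → ℝ) (p d : ℕ → ℝ) (j : ℕ) : ℝ :=
  (∑ l ∈ (Finset.Icc 1 (j - 1)).attach, weightDensity c p d (j - l) * c (j - l) l + p j) / d j
termination_by j
decreasing_by
  have := Finset.mem_Icc.1 l.2
  omega

theorem weightDensity_eq (c : ℕ → ℕ → ℝ) (p d : ℕ → ℝ) (j : ℕ) :
    weightDensity c p d j =
      (∑ l ∈ Finset.Icc 1 (j - 1), weightDensity c p d (j - l) * c (j - l) l + p j) / d j := by
  rw [weightDensity, Finset.sum_attach (Finset.Icc 1 (j - 1))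
    fun l => weightDensity c p d (j - l) * c (j - l) l]

/-- The event ν_n = 0 is null for n ≥ 1, and convergence in law on a discrete space passes this to
the limit. It makes the excess terms nonnegative. -/
theorem one_le_limit_ν {Ω Ω' : Type*} [MeasurableSpace Ω] [MeasurableSpace Ω']
    {P : Measure Ω} [IsProbabilityMeasure P] {Q : Measure Ω'} [IsProbabilityMeasure Q]
    {M : PublicationProcess Ω} {ν Y Z : Ω' → ℕ} (hν : Measurable ν)
    (hM : M.IsModel P) (h : M.Assumptions P ν Y Z Q) : ∀ᵐ ω ∂Q, 1 ≤ ν ω := by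
  have h1 := tendsto_integral_of_tendstoInDistribution h.tendsto_law
    (fun e => ({0} : Set ℕ).indicator 1 e.1) 1 fun e => by
      by_cases he : e.1 = 0 <;> simp [he]
  have h2 : ∀ᶠ n in atTop, ∫ ω, ({0} : Set ℕ).indicator (1 : ℕ → ℝ) (M.ν n ω) ∂P = 0 := by
    filter_upwards [eventually_ge_atTop 1] with n hn
    refine integral_eq_zero_of_ae ?_
    filter_upwards [hM.ν_bounds n hn] with ω hω
    exact Set.indicator_of_notMem (by simp; omega) _
  have h3 := tendsto_nhds_unique h1 (tendsto_const_nhds.congr' (h2.mono fun n hn => hn.symm))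
  have hS : MeasurableSet {ω | ν ω = 0} := hν (MeasurableSet.singleton 0)
  have h4 : Q.real {ω | ν ω = 0} = 0 := by
    rw [← h3]
    exact (integral_indicator_one hS).symm
  rw [ae_iff]
  have : {ω | ¬1 ≤ ν ω} = {ω | ν ω = 0} := by
    ext ω
    simp
  rw [this]
  exact (measureReal_eq_zero_iff).1 h4

theorem excessOn_nonneg {Ω' : Type*} [MeasurableSpace Ω'] {ν : Ω' → ℕ} {Q : Measure Ω'}
    (h : ∀ᵐ ω ∂Q, 1 ≤ ν ω) (B : Set Ω') : 0 ≤ excessOn ν Q B := by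
  refine integral_nonneg_of_ae ?_
  filter_upwards [h] with ω hω
  have : (1 : ℝ) ≤ ν ω := by exact_mod_cast hω
  exact Set.indicator_apply_nonneg fun _ => by linarith

theorem excessOn_eq_zero {Ω' : Type*} [MeasurableSpace Ω'] {ν : Ω' → ℕ} {Q : Measure Ω'}
    {B : Set Ω'} (h : Q B = 0) : excessOn ν Q B = 0 := by
  refine integral_eq_zero_of_ae ?_
  have : ∀ᵐ ω ∂Q, ω ∉ B := measure_eq_zero_iff_ae_notMem.1 h
  filter_upwards [this] with ω hω
  exact Set.indicator_of_notMem hω _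

/-- Peel off one positive bonus value. As X is almost surely nonzero, the value k left over is at
least 1, which forces l ≤ j - 1. -/
theorem attainableWeight_iff {Ω Ω' : Type*} [MeasurableSpace Ω] [MeasurableSpace Ω'] {X : Ω → ℕ}
    {P : Measure Ω} {Y : Ω' → ℕ} {Q : Measure Ω'} (hX : P {ω | X ω = 0} = 0) (j : ℕ) :
    AttainableWeight X P Y Q j ↔ 0 < P {ω | X ω = j} ∨
      ∃ l ∈ Finset.Icc 1 (j - 1), 0 < Q {ω | Y ω = l} ∧ AttainableWeight X P Y Q (j - l) := by
  constructor
  · rintro ⟨k, hk, s, hs, rfl⟩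
    have hk0 : 1 ≤ k := by
      rcases Nat.eq_zero_or_pos k with rfl | h0
      · exact absurd hX hk.ne'
      · exact h0
    -- The value 0 may be among the generators, so zero summands are discarded before a positive one
    -- is taken out.
    have key : ∀ s ∈ AddSubmonoid.closure {i : ℕ | 0 < Q {ω | Y ω = i}}, s = 0 ∨
        ∃ l, 1 ≤ l ∧ 0 < Q {ω | Y ω = l} ∧
          ∃ t ∈ AddSubmonoid.closure {i : ℕ | 0 < Q {ω | Y ω = i}}, s = l + t := by
      intro s hs
      induction hs using AddSubmonoid.closure_induction with
      | mem l hl =>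
        rcases Nat.eq_zero_or_pos l with h0 | h0
        · exact Or.inl h0
        · exact Or.inr ⟨l, h0, hl, 0, zero_mem _, rfl⟩
      | zero => exact Or.inl rfl
      | add a b _ hb iha ihb =>
        rcases iha with rfl | ⟨l, h1, h2, t, ht, rfl⟩
        · simpa using ihb
        · exact Or.inr ⟨l, h1, h2, t + b, add_mem ht hb, by ring⟩
    rcases key s hs with rfl | ⟨l, h1, h2, t, ht, rfl⟩
    · exact Or.inl hk
    · exact Or.inr ⟨l, Finset.mem_Icc.2 ⟨h1, by omega⟩, h2, k, hk, t, ht, by omega⟩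
  · rintro (hj | ⟨l, hl, h1, k, hk, s, hs, he⟩)
    · exact ⟨j, hj, 0, zero_mem _, rfl⟩
    · rw [Finset.mem_Icc] at hl
      exact ⟨k, hk, l + s, add_mem (AddSubmonoid.subset_closure h1) hs, by omega⟩

theorem theorem1 {Ω Ω' : Type*} [MeasurableSpace Ω] [MeasurableSpace Ω']
    (P : Measure Ω) [IsProbabilityMeasure P] (Q : Measure Ω') [IsProbabilityMeasure Q]
    (M : PublicationProcess Ω) (ν Y Z : Ω' → ℕ)
    (hν : Measurable ν) (hY : Measurable Y) (hZ : Measurable Z)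
    (hmodel : M.IsModel P) (hassump : M.Assumptions P ν Y Z Q)
    (EX EZ α β : ℝ)
    (hEX : EX = ∫ ω, (M.X 0 ω : ℝ) ∂P) (hEZ : EZ = ∫ ω, (Z ω : ℝ) ∂Q)
    (hα : α = Q.real {ω | 0 < Y ω} / (EX + EZ))
    (hβ : β = excessOn ν Q {ω | 0 < Y ω}) :
    ∃ x : ℕ → ℝ,
      (∀ j, 1 ≤ j →
        ∀ᵐ ω ∂P, Tendsto (fun n : ℕ => (M.ξ n j ω : ℝ) / (n : ℝ)) atTop (𝓝 (x j))) ∧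
      (∀ j, 1 ≤ j → 0 ≤ x j ∧ (0 < x j ↔ AttainableWeight (M.X 0) P Y Q j)) ∧
      (∀ j, 1 ≤ j →
        x j =
          (∑ i ∈ Finset.Icc 1 (j - 1),
              x (j - i) *
                (((j - i : ℕ) : ℝ) * Q.real {ω | Y ω = i} / (EX + EZ)
                  + excessOn ν Q {ω | Y ω = i})
            + P.real {ω | M.X 0 ω = j})
          / (α * (j : ℝ) + β + 1)) := by
  have hν1 := one_le_limit_ν hν hmodel hassump
  have hβ0 : 0 ≤ excessOn ν Q {ω | 0 < Y ω} := excessOn_nonneg hν1 _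
  have hEX1 : 1 ≤ EX := by
    have : ∫ _, (1 : ℝ) ∂P ≤ EX := by
      rw [hEX]
      refine integral_mono_ae (integrable_const _)
        (hassump.X_mgf.integrable (M.measurable_X 0)) ?_
      filter_upwards [hmodel.X_pos 0] with ω hω
      exact_mod_cast hω
    simpa using this
  have hEZ0 : 0 ≤ EZ := by rw [hEZ]; exact integral_nonneg fun _ => Nat.cast_nonneg _
  have hm0 : 0 < EX + EZ := by linarith
  have hm : EX + EZ = ∫ ω, (M.X 0 ω : ℝ) ∂P + ∫ ω, (Z ω : ℝ) ∂Q := by rw [hEX, hEZ]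
  have hd : ∀ j : ℕ, α * j + β + 1 =
      j * Q.real {ω | 0 < Y ω} / (EX + EZ) + excessOn ν Q {ω | 0 < Y ω} + 1 := fun j => by
    rw [hα, hβ]; ring
  have hd0 : ∀ j : ℕ, 0 < α * j + β + 1 := fun j => by
    rw [hd]; positivity
  let c : ℕ → ℕ → ℝ := fun w l =>
    (w : ℝ) * Q.real {ω | Y ω = l} / (EX + EZ) + excessOn ν Q {ω | Y ω = l}
  have hc0 : ∀ w l, 0 ≤ c w l := fun w l =>
    add_nonneg (by positivity) (excessOn_nonneg hν1 _)
  -- The excess vanishes on a null event, and for w ≥ 1 the preferential term is positive as soon as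
  -- P(Y = l) is.
  have hcpos : ∀ w l, 1 ≤ w → (0 < c w l ↔ 0 < Q {ω | Y ω = l}) := by
    intro w l hw
    have hw' : (0 : ℝ) < w := by exact_mod_cast hw
    constructor
    · intro hc
      refine pos_iff_ne_zero.2 fun h0 => hc.ne' ?_
      simp [c, measureReal_def, h0, excessOn_eq_zero h0]
    · intro hl
      have : 0 < Q.real {ω | Y ω = l} := ENNReal.toReal_pos hl.ne' (measure_ne_top _ _)
      exact add_pos_of_pos_of_nonneg (by positivity) (excessOn_nonneg hν1 _)
  let x := weightDensity c (fun j => P.real {ω | M.X 0 ω = j}) fun j => α * j + β + 1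
  have hx : ∀ j, x j = (∑ l ∈ Finset.Icc 1 (j - 1), x (j - l) * c (j - l) l +
      P.real {ω | M.X 0 ω = j}) / (α * j + β + 1) := weightDensity_eq _ _ _
  have hX0 : P {ω | M.X 0 ω = 0} = 0 := by
    have := ae_iff.1 (hmodel.X_pos 0)
    simpa using this
  have hpX : ∀ j, 0 < P.real {ω | M.X 0 ω = j} ↔ 0 < P {ω | M.X 0 ω = j} := fun j =>
    ENNReal.toReal_pos_iff.trans (and_iff_left (measure_lt_top _ _))
  have hx0 : ∀ j, 0 ≤ x j := fun j => by
    induction j using Nat.strong_induction_on with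
    | _ j ih =>
      rw [hx]
      refine div_nonneg (add_nonneg (Finset.sum_nonneg fun l hl => ?_) measureReal_nonneg)
        (hd0 j).le
      rw [Finset.mem_Icc] at hl
      exact mul_nonneg (ih _ (by omega)) (hc0 _ _)
  refine ⟨x, fun j _ => ?_, fun j _ => ⟨hx0 j, ?_⟩, fun j _ => hx j⟩
  · induction j using Nat.strong_induction_on with
    | _ j ih =>
      have := PublicationProcess.ae_tendsto_ξ_div hmodel hassump hν hY hZ hm hm0 hβ0 j x
        fun l hl => by
          rw [Finset.mem_Icc] at hl
          exact ih (j - l) (by omega) (by omega)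
      rwa [← hd, ← hx] at this
  · induction j using Nat.strong_induction_on with
    | _ j ih =>
      rw [attainableWeight_iff hX0, hx, div_pos_iff_of_pos_right (hd0 j), ← hpX]
      have hs0 : ∀ l ∈ Finset.Icc 1 (j - 1), 0 ≤ x (j - l) * c (j - l) l := fun l _ =>
        mul_nonneg (hx0 _) (hc0 _ _)
      -- A sum of nonnegative terms is positive exactly when some term is. The induction hypothesis
      -- translates this into attainability of j - l with a possible bonus l.
      have hs : 0 < ∑ l ∈ Finset.Icc 1 (j - 1), x (j - l) * c (j - l) l ↔
          ∃ l ∈ Finset.Icc 1 (j - 1), 0 < Q {ω | Y ω = l} ∧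
            AttainableWeight (M.X 0) P Y Q (j - l) := by
        rw [Finset.sum_pos_iff_of_nonneg hs0]
        refine exists_congr fun l => and_congr_right fun hl => ?_
        rw [Finset.mem_Icc] at hl
        rw [← ih (j - l) (by omega) (by omega), ← hcpos (j - l) l (by omega)]
        constructor
        · intro hh
          exact ⟨pos_of_mul_pos_right hh (hx0 _), pos_of_mul_pos_left hh (hc0 _ _)⟩
        · exact fun hh => mul_pos hh.2 hh.1
      rw [← hs]
      have h1 : 0 ≤ P.real {ω | M.X 0 ω = j} := measureReal_nonneg
      have h2 := Finset.sum_nonneg hs0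
      constructor
      · intro hh
        by_contra! hcon
        linarith [hcon.1, hcon.2]
      · rintro (hh | hh) <;> linarith
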